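/- Let $M$ be a (smooth) Riemannian surface with Riemannian distance $d$, let $f\colon M\to M$ be a $C^1$ diffeomorphism, and let $\Gamma\subset M$ be a basic set of $f$, that is: $\Gamma$ is compact; $f(\Gamma)=\Gamma$; $\Gamma$ is locally maximal, i.e. $\Gamma=\bigcap_{k\in\mathbb Z}f^k(V)$ for some neighborhood $V$ of $\Gamma$; $\Gamma$ is hyperbolic, i.e. for some Riemannian metric on $M$, with norm $\|\cdot\|$, there are a $df$-invariant splitting $T_\Gamma M=E^{s}\oplus E^{u}$ and numbers $0<\mu<1<\kappa$ such that $\|df\,v\|\le\mu\|v\|$ for all $v\in E^{s}_y$ and $\|df\,v\|\ge\kappa\|v\|$ for all $v\in E^{u}_y$, for every $y\in\Gamma$; and $f|_\Gamma$ is topologically mixing. Fix a neighborhood $U$ of $\Gamma$ and for $y\in\Gamma$ let $$W^{s}_{loc}(y)=\{z\in M: d(f^n(z),f^n(y))\to0 \text{ as } n\to\infty,\ f^k(z)\in U\text{ for all }k\ge0\},$$ and let $W^{u}_{loc}(y)$ be the set defined in the same way with $f^{-1}$ in place of $f$. Let $B\subset\Gamma$ be a set with $f(B)=B$ that is s-saturated,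 i.e. $\Gamma\cap W^{s}_{loc}(y)\subset B$ for every $y\in B$. Then for every $x\in\Gamma$ $$h\big(f|_\Gamma,\,B\cap W^{u}_{loc}(x)\big)=h\big(f|_\Gamma,\,B\big).$$ Here $h(T,Y)$ is Bowen's topological entropy of a continuous map $T\colon X\to X$ of a compact metric space on an arbitrary subset $Y\subset X$: for a finite open cover $\mathcal A$ of $X$ and $V\subset X$ let $n_{\mathcal A}(V)\in\{0,1,\dots,\infty\}$ be the least $\ell\ge0$ such that $T^\ell(V)$ is contained in no element of $\mathcal A$ ($\infty$ if there is no such $\ell$); for $d>0$ put $$m_{\mathcal A,d}(Y)=\lim_{\rho\to0}\inf\Big\{\sum_{V\in\mathcal V}e^{-d\,n_{\mathcal A}(V)}\Big\},$$ the infimum being over the countable families $\mathcal V$ of open sets that cover $Y$ with $e^{-n_{\mathcal A}(V)}<\rho$ for all $V\in\mathcal V$; and $h(T,Y)=\sup_{\mathcal A}\inf\{d>0: m_{\mathcal A,d}(Y)=0\}$, the supremum being over all finite open covers $\mathcal A$ of $X$. -/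

import Mathlib

open Set Filter Topology Manifold Bundle
open scoped ENNReal ContDiff

noncomputable section

namespace SurfaceDynamics

section Entropy

variable {X : Type*}

/-- `U ≺ 𝒜`: the set `U` is contained in some member of the cover `𝒜`. -/
def Subordinate (U : Set X) (𝒜 : Set (Set X)) : Prop :=
  ∃ A ∈ 𝒜, U ⊆ A

open Classical in
/-- The number `n_{T,𝒜}(U)`: the least `ℓ ≥ 0` such that `T^ℓ(U) ⊀ 𝒜`
(so it is `0` if already `U ⊀ 𝒜`), and `∞` if `T^k(U) ≺ 𝒜` for all `k ≥ 0`. -/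
def escapeTime (T : X → X) (𝒜 : Set (Set X)) (U : Set X) : ℕ∞ :=
  if h : ∃ ℓ : ℕ, ¬ Subordinate (T^[ℓ] '' U) 𝒜 then (Nat.find h : ℕ∞) else ⊤

/-- The number `e^{-d n}` for `n ∈ ℕ ∪ {∞}` and `d > 0`, with `e^{-d ∞} = 0`. -/
def expNeg (d : ℝ) (n : ℕ∞) : ℝ≥0∞ :=
  if n = ⊤ then 0 else ENNReal.ofReal (Real.exp (-(d * (n.toNat : ℝ))))

variable [TopologicalSpace X]

/-- The finite open covers of the space `X`. -/
def IsFiniteOpenCover (𝒜 : Set (Set X)) : Prop :=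
  𝒜.Finite ∧ (∀ A ∈ 𝒜, IsOpen A) ∧ ⋃₀ 𝒜 = univ

/-- The countable families `𝒰` of open sets that cover `Y` and all of whose members satisfy
`e^{-n_{T,𝒜}(U)} < ρ`. -/
def AdmissibleCovers (T : X → X) (𝒜 : Set (Set X)) (Y : Set X) (ρ : ℝ) :
    Set (Set (Set X)) :=
  {𝒰 | 𝒰.Countable ∧ (∀ U ∈ 𝒰, IsOpen U) ∧ Y ⊆ ⋃₀ 𝒰 ∧
    ∀ U ∈ 𝒰, expNeg 1 (escapeTime T 𝒜 U) < ENNReal.ofReal ρ}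

/-- Bowen's outer measure `m_{𝒜,d}(Y)`: the limit as `ρ → 0`, that is, the supremum over
`ρ > 0`, of the infimum of `∑_{U ∈ 𝒰} e^{-d n_{T,𝒜}(U)}` over the admissible covers `𝒰`. -/
def bowenMeasure (T : X → X) (𝒜 : Set (Set X)) (d : ℝ) (Y : Set X) : ℝ≥0∞ :=
  ⨆ (ρ : ℝ) (_ : 0 < ρ), ⨅ 𝒰 ∈ AdmissibleCovers T 𝒜 Y ρ,
    ∑' U : 𝒰, expNeg d (escapeTime T 𝒜 (U : Set X))

/-- `h_𝒜(T, Y) = inf {d > 0 : m_{𝒜,d}(Y) = 0}`. -/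
def bowenEntropyCover (T : X → X) (𝒜 : Set (Set X)) (Y : Set X) : ℝ≥0∞ :=
  ⨅ (d : ℝ) (_ : 0 < d) (_ : bowenMeasure T 𝒜 d Y = 0), ENNReal.ofReal d

/-- Bowen's topological entropy `h(T, Y)` of `T : X → X` on an arbitrary subset `Y` of the
compact space `X`: the supremum of `h_𝒜(T, Y)` over all finite open covers `𝒜` of `X`. -/
def bowenEntropy (T : X → X) (Y : Set X) : ℝ≥0∞ :=
  ⨆ (𝒜 : Set (Set X)) (_ : IsFiniteOpenCover 𝒜), bowenEntropyCover T 𝒜 Y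

/-- Topological mixing. -/
def IsTopologicallyMixing (T : X → X) : Prop :=
  ∀ V W : Set X, IsOpen V → IsOpen W → V.Nonempty → W.Nonempty →
    ∃ N : ℕ, ∀ n : ℕ, N ≤ n → (T^[n] '' V ∩ W).Nonempty

end Entropy

section InvariantManifolds

variable {M : Type*} [PseudoEMetricSpace M]

/-- The stable manifold `W^s(x, f)`: all `y` with `d(f^n(y), f^n(x)) → 0` as `n → ∞`. -/
def stableManifold (f : M → M) (x : M) : Set M :=
  {y | Tendsto (fun n : ℕ => edist (f^[n] y) (f^[n] x)) atTop (𝓝 0)}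

/-- The local stable manifold `W^s_loc(x, f)` with respect to the set `U`. -/
def localStableManifold (f : M → M) (U : Set M) (x : M) : Set M :=
  {y | y ∈ stableManifold f x ∧ ∀ k : ℕ, f^[k] y ∈ U}

/-- The local unstable manifold `W^u_loc(x, f)` with respect to the set `U`: the local stable
manifold of `f⁻¹`. -/
def localUnstableManifold (f : M ≃ M) (U : Set M) (x : M) : Set M :=
  localStableManifold f.symm U x

/-- `B ⊆ Γ` is s-saturated with respect to `f|_Γ` (and the neighbourhood `U` of `Γ`). -/
def IsSSaturated (f : M → M) (U Γ B : Set M) : Prop :=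
  B ⊆ Γ ∧ ∀ x ∈ B, Γ ∩ localStableManifold f U x ⊆ B

end InvariantManifolds

section Hyperbolicity

/-- `Γ` is locally maximal for `f`: `Γ = ⋂_{k ∈ ℤ} f^k(V)` for some neighbourhood `V` of `Γ`. -/
def IsLocallyMaximal {M : Type*} [TopologicalSpace M] (f : Equiv.Perm M) (Γ : Set M) : Prop :=
  ∃ V ∈ 𝓝ˢ Γ, Γ = ⋂ k : ℤ, ⇑(f ^ k) '' V

variable {E : Type*} [NormedAddCommGroup E] [NormedSpace ℝ E]
  {H : Type*} [TopologicalSpace H] (I : ModelWithCorners ℝ E H)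
  {M : Type*} [TopologicalSpace M] [ChartedSpace H M] [IsManifold I 1 M]

/-- The norm of a tangent vector with respect to a Riemannian metric `g` on `M`. -/
def metricNorm (g : ContinuousRiemannianMetric E (fun x : M => TangentSpace I x))
    {x : M} (v : TangentSpace I x) : ℝ :=
  Real.sqrt (g.inner x v v)

/-- `Γ` is a hyperbolic set of the differentiable map `f`: for some Riemannian metric on `M`
(not necessarily a given one) there are a `df`-invariant splitting `T_Γ M = E^s ⊕ E^u` and
numbers `0 < μ < 1 < κ` such that `df` contracts `E^s` at least by the factor `μ` and expands
`E^u` at least by the factor `κ`. -/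
def IsHyperbolicSet (f : M → M) (Γ : Set M) : Prop :=
  ∃ g : ContinuousRiemannianMetric E (fun x : M => TangentSpace I x),
  ∃ Es Eu : ∀ x : M, Submodule ℝ (TangentSpace I x),
  ∃ μ κ : ℝ, 0 < μ ∧ μ < 1 ∧ 1 < κ ∧
    ∀ x ∈ Γ,
      IsCompl (Es x) (Eu x) ∧
      (Es x).map (mfderiv I I f x).toLinearMap = Es (f x) ∧
      (Eu x).map (mfderiv I I f x).toLinearMap = Eu (f x) ∧
      (∀ v ∈ Es x, metricNorm I g (mfderiv I I f x v) ≤ μ * metricNorm I g v) ∧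
      (∀ v ∈ Eu x, κ * metricNorm I g v ≤ metricNorm I g (mfderiv I I f x v))

/-- `Γ` is a basic set of the `C^1` diffeomorphism `f`: compact, invariant, locally maximal,
hyperbolic, and such that `f|_Γ` is topologically mixing. -/
structure IsBasicSet (f : M ≃ₘ^1⟮I, I⟯ M) (Γ : Set M) : Prop where
  isCompact : IsCompact Γ
  image_eq : f '' Γ = Γ
  locallyMaximal : IsLocallyMaximal f.toEquiv Γ
  hyperbolic : IsHyperbolicSet I f Γ
  mixing : IsTopologicallyMixing ((mapsTo_iff_image_subset.2 image_eq.subset).restrict f Γ Γ)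

variable {I}

theorem IsBasicSet.mapsTo {f : M ≃ₘ^1⟮I, I⟯ M} {Γ : Set M} (h : IsBasicSet I f Γ) :
    MapsTo f Γ Γ :=
  mapsTo_iff_image_subset.2 h.image_eq.subset

end Hyperbolicity

end SurfaceDynamics

end

open Set Filter Topology Manifold Bundle
open scoped ENNReal ContDiff

noncomputable section

/-! One inequality is monotonicity of entropy. The other rests on heteroclinic points: for `p ∈ Γ`
and `η > 0` some `q ∈ Γ` has a forward orbit that stays `η`-close and converges to that of `p`,
while its backward orbit converges to that of `x` (`IsBasicSet.exists_heteroclinic`). If `p ∈ B`,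
saturation puts `q` in `B`, and `q` lies in the local unstable manifold of `x`. So every point of
`B` is followed for all forward times, as closely as desired, by a point of the smaller set. Bowen
entropy cannot see the difference: thickening an open cover of the smaller set along orbit segments
covers `B` at almost the same cost (`bowenEntropy_le_of_forall_exists_edist_lt`).

Heteroclinic points come from mixing, expansivity and local product structure. The last two are the
uniqueness and existence halves of shadowing. Read in charts along a pseudo-orbit, an iterate of `f`
is a small Lipschitz perturbation of hyperbolic linear maps, and a Newton operator on bounded
sequences is a contraction whose fixed points are the true orbits. Local maximality places the
shadowing orbit in `Γ`.

The charts need a continuous splitting, which the definition of hyperbolicity does not provide. It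
follows because the stable spaces are cut out by closed conditions: a vector over `Γ` is stable
exactly when the iterates of `df` do not lengthen it. -/

namespace SurfaceDynamics

/-! ### Shadowing for sequences of nearly linear hyperbolic maps -/

section AbstractShadowing

variable {E : Type*} [NormedAddCommGroup E] [NormedSpace ℝ E]

/-- A map `F : E → E` which, on the closed ball of radius `ρ`, is `ε`-close in the Lipschitz sense
to an invertible linear map `A`. The map `A` carries the projection `P₀` to a projection `P'` that
is `ε`-close to `P₁`; it contracts the range of `P₀`, and its inverse contracts the kernel
of `P'`. -/
def IsHyperbolicStep (C ε ρ : ℝ) (P₀ P₁ : E →L[ℝ] E) (F : E → E) : Prop :=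
  ∃ (A : E ≃L[ℝ] E) (P' : E →L[ℝ] E),
    (∀ v, P' (P' v) = P' v) ∧ (∀ v, A (P₀ v) = P' (A v)) ∧
    (∀ v, ‖A (P₀ v)‖ ≤ ‖v‖ / 8) ∧ (∀ v, ‖A.symm (v - P' v)‖ ≤ ‖v‖ / 8) ∧
    (∀ v, ‖P' v‖ ≤ C * ‖v‖) ∧ (∀ v, ‖P₁ v - P' v‖ ≤ ε * ‖v‖) ∧
    ∀ v w, ‖v‖ ≤ ρ → ‖w‖ ≤ ρ → ‖F v - F w - A (v - w)‖ ≤ ε * ‖v - w‖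

/-- Newton's operator for the equations `v (n + 1) = F n (v n)`. -/
def newtonStep (F : ℤ → E → E) (A : ℤ → E ≃L[ℝ] E) (P' : ℤ → E →L[ℝ] E) (v : ℤ → E) (n : ℤ) : E :=
  v n - P' (n - 1) (v n - F (n - 1) (v (n - 1)))
    + (A n).symm ((v (n + 1) - F n (v n)) - P' n (v (n + 1) - F n (v n)))

variable {C ε ρ : ℝ} {P : ℤ → E →L[ℝ] E} {F : ℤ → E → E}
  {A : ℤ → E ≃L[ℝ] E} {P' : ℤ → E →L[ℝ] E}

/-- For exactly linear steps with matching projections the operator sends stable errors forward and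
pulls unstable errors back, so each contributes a factor 1/8. The mismatch of projections and the
nonlinearity together cost at most `ε * (C + 2)`. -/
theorem newtonStep_contracts (hε : 0 ≤ ε) (hC : 0 ≤ C) (hCε : ε * (C + 2) ≤ 1 / 4)
    (hA : ∀ n v, A n (P n v) = P' n (A n v))
    (hs : ∀ n v, ‖A n (P n v)‖ ≤ ‖v‖ / 8)
    (hu : ∀ n v, ‖(A n).symm (v - P' n v)‖ ≤ ‖v‖ / 8)
    (hb : ∀ n v, ‖P' n v‖ ≤ C * ‖v‖) (hd : ∀ n v, ‖P (n + 1) v - P' n v‖ ≤ ε * ‖v‖)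
    (hF : ∀ n v w, ‖v‖ ≤ ρ → ‖w‖ ≤ ρ → ‖F n v - F n w - A n (v - w)‖ ≤ ε * ‖v - w‖)
    {v w : ℤ → E} (hv : ∀ n, ‖v n‖ ≤ ρ) (hw : ∀ n, ‖w n‖ ≤ ρ) {D : ℝ}
    (hD : ∀ n, ‖v n - w n‖ ≤ D) (n : ℤ) :
    ‖newtonStep F A P' v n - newtonStep F A P' w n‖ ≤ D / 2 := by
  have hD0 : 0 ≤ D := (norm_nonneg _).trans (hD 0)
  set d : ℤ → E := fun k => v k - w k
  set s : ℤ → E := fun k => F k (v k) - F k (w k) - A k (d k)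
  have hs' : ∀ k, ‖s k‖ ≤ ε * D := fun k =>
    (hF k _ _ (hv k) (hw k)).trans (mul_le_mul_of_nonneg_left (hD k) hε)
  -- Since `(A n).symm ∘ (1 - P' n) ∘ A n = 1 - P n`, the two identity terms in `d n` cancel and
  -- only the mismatch `P n - P' (n - 1)` survives.
  have key : newtonStep F A P' v n - newtonStep F A P' w n =
      (P n (d n) - P' (n - 1) (d n)) + A (n - 1) (P (n - 1) (d (n - 1))) + P' (n - 1) (s (n - 1))
        + (A n).symm (d (n + 1) - P' n (d (n + 1))) - (A n).symm (s n - P' n (s n)) := by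
    have h1 : P n (d n) = (A n).symm (P' n (A n (d n))) := by
      rw [← hA, ContinuousLinearEquiv.symm_apply_apply]
    rw [h1, hA]
    simp only [newtonStep, s, d, map_sub, ContinuousLinearEquiv.symm_apply_apply]
    abel
  rw [key]
  have b1 : ‖P n (d n) - P' (n - 1) (d n)‖ ≤ ε * D := by
    have := hd (n - 1) (d n)
    rw [sub_add_cancel] at this
    exact this.trans (mul_le_mul_of_nonneg_left (hD n) hε)
  have b2 : ‖A (n - 1) (P (n - 1) (d (n - 1)))‖ ≤ D / 8 :=
    (hs _ _).trans (by linarith [hD (n - 1)])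
  have b3 : ‖P' (n - 1) (s (n - 1))‖ ≤ C * (ε * D) :=
    (hb _ _).trans (mul_le_mul_of_nonneg_left (hs' _) hC)
  have b4 : ‖(A n).symm (d (n + 1) - P' n (d (n + 1)))‖ ≤ D / 8 :=
    (hu _ _).trans (by linarith [hD (n + 1)])
  have b5 : ‖(A n).symm (s n - P' n (s n))‖ ≤ ε * D / 8 :=
    (hu _ _).trans (by linarith [hs' n])
  have t := norm_sub_le_of_le (norm_add_le_of_le (norm_add_le_of_le (norm_add_le_of_le b1 b2) b3)
      b4) b5
  have : ε * (C + 2) * D ≤ 1 / 4 * D := mul_le_mul_of_nonneg_right hCε hD0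
  nlinarith [mul_nonneg hε hD0]

/-- At a fixed point the stable part of one error equals the pulled-back unstable part of the next.
The latter is killed by `P (n + 1)`, which is `ε`-close to `P' n`, the identity on the former; as `ε
< 1`, both vanish. -/
theorem newtonStep_eq_self_iff (hε : ε < 1)
    (hP : ∀ n v, P' n (P' n v) = P' n v) (hA : ∀ n v, A n (P n v) = P' n (A n v))
    (hd : ∀ n v, ‖P (n + 1) v - P' n v‖ ≤ ε * ‖v‖) {v : ℤ → E} :
    (∀ n, newtonStep F A P' v n = v n) ↔ ∀ n, v (n + 1) = F n (v n) := by
  constructor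
  · intro h
    set e : ℤ → E := fun n => v (n + 1) - F n (v n)
    have h1 : ∀ n, P' n (e n) = (A (n + 1)).symm (e (n + 1) - P' (n + 1) (e (n + 1))) := by
      intro n
      have := h (n + 1)
      rw [newtonStep, add_sub_cancel_right] at this
      rw [sub_add, sub_eq_self, sub_eq_zero] at this
      exact this
    have h2 : ∀ n, P' n (e n) = 0 := by
      intro n
      have h3 : P (n + 1) (P' n (e n)) = 0 := by
        apply (A (n + 1)).injective
        rw [hA, h1, ContinuousLinearEquiv.apply_symm_apply, map_sub, hP, sub_self, map_zero]
      have h4 := hd n (P' n (e n))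
      rw [h3, hP, zero_sub, norm_neg] at h4
      by_contra hne
      have := norm_pos_iff.2 hne
      nlinarith
    intro n
    have h5 := h1 (n - 1)
    rw [h2, sub_add_cancel, h2, sub_zero, eq_comm, map_eq_zero_iff _ (A n).symm.injective] at h5
    exact sub_eq_zero.1 h5
  · intro h n
    have h1 := h (n - 1)
    rw [sub_add_cancel] at h1
    rw [newtonStep, ← h n, ← h1]
    simp

/-- Banach's fixed point theorem on the `ρ`-ball of bounded sequences. The ball is preserved because
the zero sequence moves by at most `ρ / 2` and the contraction factor is 1/2. -/
theorem exists_orbit_of_isHyperbolicStep [CompleteSpace E] (hε : 0 ≤ ε) (hC : 0 ≤ C)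
    (hCε : ε * (C + 2) ≤ 1 / 4) (hρ : 0 ≤ ρ)
    (h : ∀ n, IsHyperbolicStep C ε ρ (P n) (P (n + 1)) (F n))
    (h0 : ∀ n, (C + 1) * ‖F n 0‖ ≤ ρ / 2) :
    ∃ v : ℤ → E, (∀ n, ‖v n‖ ≤ ρ) ∧ ∀ n, v (n + 1) = F n (v n) := by
  choose A P' hP hA hs hu hb hd hF using h
  have hε1 : ε < 1 := by nlinarith
  have hc {v w : ℤ → E} (hv : ∀ n, ‖v n‖ ≤ ρ) (hw : ∀ n, ‖w n‖ ≤ ρ) {D : ℝ}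
      (hD : ∀ n, ‖v n - w n‖ ≤ D) (n : ℤ) :
      ‖newtonStep F A P' v n - newtonStep F A P' w n‖ ≤ D / 2 :=
    newtonStep_contracts hε hC hCε hA hs hu hb hd hF hv hw hD n
  have hz : ∀ n, ‖newtonStep F A P' 0 n‖ ≤ ρ / 2 := by
    intro n
    have b1 := hb (n - 1) (F (n - 1) 0)
    have b2 := hu n (F n 0)
    have e1 : newtonStep F A P' 0 n =
        P' (n - 1) (F (n - 1) 0) - (A n).symm (F n 0 - P' n (F n 0)) := by
      simp [newtonStep]; abel
    rw [e1]
    refine (norm_sub_le_of_le b1 b2).trans ?_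
    have c1 := h0 n
    have c2 := h0 (n - 1)
    have k1 : ‖F n 0‖ ≤ ρ / 2 / (C + 1) := by
      rw [le_div_iff₀ (by linarith)]; linarith
    have k2 : ‖F (n - 1) 0‖ ≤ ρ / 2 / (C + 1) := by
      rw [le_div_iff₀ (by linarith)]; linarith
    have k3 : C * ‖F (n - 1) 0‖ ≤ C * (ρ / 2 / (C + 1)) := mul_le_mul_of_nonneg_left k2 hC
    have k4 : (C + 1) * (ρ / 2 / (C + 1)) = ρ / 2 := by field_simp
    nlinarith [norm_nonneg (F n 0)]
  have hmap : ∀ v : ℤ → E, (∀ n, ‖v n‖ ≤ ρ) → ∀ n, ‖newtonStep F A P' v n‖ ≤ ρ := by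
    intro v hv n
    have h1 := hc (v := v) (w := 0) (D := ρ) hv (by simpa using hρ) (by simpa using hv) n
    have := norm_add_le_of_le h1 (hz n)
    rw [sub_add_cancel] at this
    linarith
  let Z := Metric.closedBall (0 : BoundedContinuousFunction ℤ E) ρ
  have hZ : ∀ {v : BoundedContinuousFunction ℤ E}, v ∈ Z ↔ ∀ n, ‖v n‖ ≤ ρ := by
    intro v
    rw [mem_closedBall_zero_iff, BoundedContinuousFunction.norm_le hρ]
  let Φ : Z → Z := fun v =>
    ⟨BoundedContinuousFunction.ofNormedAddCommGroupDiscrete (newtonStep F A P' (v :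
        BoundedContinuousFunction ℤ E)) ρ
      (hmap _ (hZ.1 v.2)), hZ.2 (hmap _ (hZ.1 v.2))⟩
  have hΦ : ContractingWith (1 / 2) Φ := by
    refine ⟨by rw [← NNReal.coe_lt_coe]; norm_num, LipschitzWith.of_dist_le_mul fun v w => ?_⟩
    rw [Subtype.dist_eq, BoundedContinuousFunction.dist_le (by positivity)]
    intro n
    have h1 := hc (hZ.1 v.2) (hZ.1 w.2) (D := dist v w) (fun k => by
      rw [← dist_eq_norm]
      exact BoundedContinuousFunction.dist_coe_le_dist k) n
    rw [dist_eq_norm]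
    refine h1.trans (le_of_eq ?_)
    push_cast
    ring
  have : Nonempty Z := ⟨⟨0, hZ.2 (by simpa using hρ)⟩⟩
  have : CompleteSpace Z := Metric.isClosed_closedBall.completeSpace_coe
  obtain ⟨v, hv⟩ : ∃ v, Φ v = v := ⟨_, hΦ.fixedPoint_isFixedPt⟩
  refine ⟨(v : BoundedContinuousFunction ℤ E), hZ.1 v.2, (newtonStep_eq_self_iff hε1 hP hA hd).1
      fun n => ?_⟩
  exact DFunLike.congr_fun (congrArg Subtype.val hv) n

/-- Both orbits are fixed by the Newton operator, so any bound on their distance can be halved,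
starting from `2 * ρ`. -/
theorem orbit_unique_of_isHyperbolicStep (hε : 0 ≤ ε) (hC : 0 ≤ C)
    (hCε : ε * (C + 2) ≤ 1 / 4)
    (h : ∀ n, IsHyperbolicStep C ε ρ (P n) (P (n + 1)) (F n)) {v w : ℤ → E}
    (hv : ∀ n, ‖v n‖ ≤ ρ) (hw : ∀ n, ‖w n‖ ≤ ρ)
    (hvo : ∀ n, v (n + 1) = F n (v n)) (hwo : ∀ n, w (n + 1) = F n (w n)) : v = w := by
  choose A P' hP hA hs hu hb hd hF using h
  have hε1 : ε < 1 := by nlinarith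
  have key : ∀ D : ℝ, (∀ n, ‖v n - w n‖ ≤ D) → ∀ n, ‖v n - w n‖ ≤ D / 2 := by
    intro D hD n
    have := newtonStep_contracts hε hC hCε hA hs hu hb hd hF hv hw hD n
    rwa [(newtonStep_eq_self_iff hε1 hP hA hd).2 hvo, (newtonStep_eq_self_iff hε1 hP hA hd).2 hwo]
      at this
  have hpow : ∀ k : ℕ, ∀ n, ‖v n - w n‖ ≤ 2 * ρ * (1 / 2) ^ k := by
    intro k
    induction k with
    | zero => intro n; have := norm_sub_le_of_le (hv n) (hw n); simpa [two_mul] using this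
    | succ k ih => intro n; have := key _ ih n; rw [pow_succ]; linarith
  funext n
  rw [← sub_eq_zero, ← norm_le_zero_iff]
  refine ge_of_tendsto' (x := atTop) (f := fun k : ℕ => 2 * ρ * (1 / 2 : ℝ) ^ k) ?_ fun k => hpow
      k n
  simpa using (tendsto_pow_atTop_nhds_zero_of_lt_one (by norm_num : (0:ℝ) ≤ 1 / 2)
    (by norm_num)).const_mul (2 * ρ)

end AbstractShadowing

/-! ### Continuity of splittings -/

section Splitting

variable {E : Type*} [NormedAddCommGroup E] [NormedSpace ℝ E] [FiniteDimensional ℝ E]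

/-- The projections of a splitting into two closed families of subspaces depend continuously on
the base point. -/
theorem continuous_projection_of_isClosed {X : Type*} [TopologicalSpace X]
    [FirstCountableTopology X] {Es Eu : X → Submodule ℝ E} (hdisj : ∀ x, Disjoint (Es x) (Eu x))
    (hs : IsClosed {p : X × E | p.2 ∈ Es p.1}) (hu : IsClosed {p : X × E | p.2 ∈ Eu p.1})
    {P : X → E →L[ℝ] E} (hP : ∀ x v, P x v ∈ Es x) (hQ : ∀ x v, v - P x v ∈ Eu x) :
    Continuous P := by
  rw [continuous_clm_apply]
  intro v
  refine SeqContinuous.continuous ?_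
  intro x a hx
  refine tendsto_of_subseq_tendsto fun ns hns => ?_
  set y : ℕ → X := fun k => x (ns k)
  have hy : Tendsto y atTop (𝓝 a) := hx.comp hns
  -- The projections are not known to be bounded, so the vectors are rescaled into the unit ball
  -- before compactness is applied.
  set t : ℕ → ℝ := fun k => (1 + ‖P (y k) v‖)⁻¹
  have htpos : ∀ k, 0 < t k := fun k => by positivity
  have ht : ∀ k, t k * (1 + ‖P (y k) v‖) = 1 := fun k => inv_mul_cancel₀ (by positivity)
  have hmem : ∀ k, (t k • P (y k) v, t k) ∈ Metric.closedBall (0 : E) 1 ×ˢ Icc (0 : ℝ) 1 := by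
    intro k
    refine ⟨?_, (htpos k).le, ?_⟩
    · rw [mem_closedBall_zero_iff, norm_smul, Real.norm_of_nonneg (htpos k).le]
      linarith [ht k, htpos k]
    · nlinarith [ht k, htpos k, norm_nonneg (P (y k) v)]
  obtain ⟨⟨w, r⟩, hwr, ms, hms, hlim⟩ :=
    ((isCompact_closedBall (0 : E) 1).prod isCompact_Icc).tendsto_subseq hmem
  have hw : Tendsto (fun k => t (ms k) • P (y (ms k)) v) atTop (𝓝 w) :=
    (continuous_fst.tendsto _).comp hlim
  have hr : Tendsto (fun k => t (ms k)) atTop (𝓝 r) := (continuous_snd.tendsto _).comp hlim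
  have hym : Tendsto (fun k => y (ms k)) atTop (𝓝 a) := hy.comp hms.tendsto_atTop
  have hwS : w ∈ Es a := hs.mem_of_tendsto (hym.prodMk_nhds hw)
    (Eventually.of_forall fun k => (Es _).smul_mem _ (hP _ _))
  have hwU : r • v - w ∈ Eu a := hu.mem_of_tendsto (hym.prodMk_nhds ((hr.smul_const v).sub hw))
    (Eventually.of_forall fun k => by
      simpa only [smul_sub, mem_ofPred_eq] using (Eu _).smul_mem (t (ms k)) (hQ (y (ms k)) v))
  have hnorm : ‖w‖ = 1 - r := by
    refine tendsto_nhds_unique hw.norm ((tendsto_const_nhds.sub hr).congr fun k => ?_)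
    rw [norm_smul, Real.norm_of_nonneg (htpos _).le]
    linarith [ht (ms k)]
  have hwP : w = r • P a v := by
    have h1 : w - r • P a v ∈ Es a := (Es a).sub_mem hwS ((Es a).smul_mem _ (hP a v))
    have h2 : w - r • P a v ∈ Eu a := by
      have := (Eu a).sub_mem ((Eu a).smul_mem r (hQ a v)) hwU
      rwa [smul_sub, sub_sub_sub_cancel_left] at this
    exact sub_eq_zero.1 ((Submodule.disjoint_def.1 (hdisj a)) _ h1 h2)
  -- Blow-up of the projections would mean `r = 0`, hence `w = 0`, although `‖w‖ = 1 - r`.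
  have hr0 : r ≠ 0 := by
    rintro rfl
    simp [hwP] at hnorm
  refine ⟨ms, ?_⟩
  have h3 := (hr.inv₀ hr0).smul hw
  rw [hwP, inv_smul_smul₀ hr0] at h3
  exact h3.congr fun k => inv_smul_smul₀ (htpos _).ne' _

theorem exists_projection_of_isCompl {S U : Submodule ℝ E} (h : IsCompl S U) :
    ∃ P : E →L[ℝ] E, (∀ v, P v ∈ S) ∧ ∀ v, v - P v ∈ U := by
  refine ⟨(S.projection U h).toContinuousLinearMap, fun v => S.projection_apply_mem h v,
    fun v => ?_⟩
  have := S.projection_add_projection_eq_self h v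
  rw [LinearMap.coe_toContinuousLinearMap', sub_eq_of_eq_add' this.symm]
  exact U.projection_apply_mem h.symm v
end Splitting

/-- A `C^1` map is strictly differentiable, uniformly over a compact set. -/
theorem exists_uniform_strict_fderiv {E F : Type*} [NormedAddCommGroup E] [NormedSpace ℝ E]
    [NormedAddCommGroup F] [NormedSpace ℝ F]
    {G : E → F} {O K : Set E} (hO : IsOpen O)
    (hG : ContDiffOn ℝ 1 G O) (hK : IsCompact K) (hKO : K ⊆ O) {ε : ℝ} (hε : 0 < ε) :
    ∃ ρ > 0, ∀ a ∈ K, Metric.closedBall a ρ ⊆ O ∧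
      ∀ v ∈ Metric.closedBall a ρ, ∀ w ∈ Metric.closedBall a ρ,
        ‖G v - G w - fderiv ℝ G a (v - w)‖ ≤ ε * ‖v - w‖ := by
  obtain ⟨ρ₁, hρ₁, h₁⟩ := hK.exists_cthickening_subset_open hO hKO
  have hc : ∀ a ∈ K, ContinuousAt (fderiv ℝ G) a := fun a ha =>
    (hG.continuousOn_fderiv_of_isOpen hO le_rfl).continuousAt (hO.mem_nhds (hKO ha))
  obtain ⟨ρ₂, hρ₂, h₂⟩ := Metric.mem_uniformity_dist.1
    (hK.uniformContinuousAt_of_continuousAt _ hc (Metric.dist_mem_uniformity hε))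
  refine ⟨min ρ₁ (ρ₂ / 2), by positivity, fun a ha => ?_⟩
  have hsub : Metric.closedBall a (min ρ₁ (ρ₂ / 2)) ⊆ O :=
    (Metric.closedBall_subset_closedBall (min_le_left _ _)).trans
      ((Metric.closedBall_subset_cthickening ha _).trans h₁)
  refine ⟨hsub, fun v hv w hw => ?_⟩
  refine (convex_closedBall a (min ρ₁ (ρ₂ / 2))).norm_image_sub_le_of_norm_fderiv_le' (𝕜 := ℝ)
    (fun b hb => (hG.differentiableOn one_ne_zero).differentiableAt (hO.mem_nhds (hsub hb)))
    (fun b hb => ?_) hw hv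
  rw [← dist_eq_norm, dist_comm]
  refine (h₂ ?_ ha).le
  rw [dist_comm]
  exact (Metric.mem_closedBall.1 hb).trans_lt ((min_le_right _ _).trans_lt (by linarith))

/-! ### Hyperbolic splittings: inverses, iterates, closedness -/

section SplitHyperbolic

variable {E : Type*} [NormedAddCommGroup E] [NormedSpace ℝ E]
  {M : Type*} [TopologicalSpace M] [ChartedSpace E M]

theorem exists_mfderiv_eq (h : M ≃ₘ^1⟮𝓘(ℝ, E), 𝓘(ℝ, E)⟯ M) (x : M)
    (v : TangentSpace 𝓘(ℝ, E) (h x)) :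
    ∃ w : TangentSpace 𝓘(ℝ, E) x, mfderiv 𝓘(ℝ, E) 𝓘(ℝ, E) h x w = v :=
  (h.mfderivToContinuousLinearEquiv one_ne_zero x).surjective v

/-- The identity lives in the total space because `h.symm (h x)` and `x` index formally different
fibres. -/
theorem mfderiv_symm_mfderiv (h : M ≃ₘ^1⟮𝓘(ℝ, E), 𝓘(ℝ, E)⟯ M) (x : M)
    (v : TangentSpace 𝓘(ℝ, E) x) :
    (⟨h.symm (h x), mfderiv 𝓘(ℝ, E) 𝓘(ℝ, E) h.symm (h x) (mfderiv 𝓘(ℝ, E) 𝓘(ℝ, E) h x v)⟩ :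
      TangentBundle 𝓘(ℝ, E) M) = ⟨x, v⟩ := by
  have h1 : tangentMap 𝓘(ℝ, E) 𝓘(ℝ, E) (h.symm ∘ h) ⟨x, v⟩ = _ :=
    tangentMap_comp_at (I := 𝓘(ℝ, E)) (I' := 𝓘(ℝ, E)) (I'' := 𝓘(ℝ, E)) (⟨x,
        v⟩ : TangentBundle 𝓘(ℝ, E) M)
      (h.symm.contMDiff.mdifferentiable one_ne_zero _) (h.contMDiff.mdifferentiable one_ne_zero _)
  have h2 : h.symm ∘ h = id := funext h.symm_apply_apply
  rw [h2, tangentMap_id] at h1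
  exact h1.symm

variable [IsManifold 𝓘(ℝ, E) 1 M]

/-- The quadratic form of a Riemannian metric, as a function on the tangent bundle. -/
def metricForm (g : ContinuousRiemannianMetric E (fun x : M => TangentSpace 𝓘(ℝ, E) x))
    (p : TangentBundle 𝓘(ℝ, E) M) : ℝ :=
  g.inner p.1 p.2 p.2

theorem continuous_metricForm
    (g : ContinuousRiemannianMetric E (fun x : M => TangentSpace 𝓘(ℝ, E) x)) :
    Continuous (metricForm g) := by
  have h : Continuous fun p : TangentBundle 𝓘(ℝ, E) M =>
      (TotalSpace.mk' ℝ p.1 (g.inner p.1 p.2 p.2) : TotalSpace ℝ (Bundle.Trivial M ℝ)) := by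
    apply Continuous.clm_bundle_apply₂ (F₁ := E) (F₂ := E)
    · exact g.continuous.comp (FiberBundle.continuous_proj E _)
    · exact continuous_id
    · exact continuous_id
  exact (Trivial.homeomorphProd M ℝ).continuous.snd.comp h

theorem metricForm_nonneg (g : ContinuousRiemannianMetric E (fun x : M => TangentSpace 𝓘(ℝ, E) x))
    (p : TangentBundle 𝓘(ℝ, E) M) : 0 ≤ metricForm g p := by
  by_cases h : p.2 = 0
  · simp [metricForm, h]
  · exact (g.pos p.1 p.2 h).le

theorem metricForm_sub_le
    (g : ContinuousRiemannianMetric E (fun x : M => TangentSpace 𝓘(ℝ, E) x)) (x : M)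
    (v w : TangentSpace 𝓘(ℝ, E) x) :
    metricForm g ⟨x, v - w⟩ ≤ 2 * metricForm g ⟨x, v⟩ + 2 * metricForm g ⟨x, w⟩ := by
  have h := metricForm_nonneg g ⟨x, v + w⟩
  simp only [metricForm, map_add, map_sub, add_apply, sub_apply] at h ⊢
  linarith

/-- The derivative of the diffeomorphism `h` maps the splitting `Es ⊕ Eu` over the invariant set
`Γ` to itself; it contracts the squared lengths on `Es` and expands them on `Eu`, by the
factor `θ`. -/
structure IsSplitHyperbolic
    (g : ContinuousRiemannianMetric E (fun x : M => TangentSpace 𝓘(ℝ, E) x)) (Γ : Set M)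
    (Es Eu : ∀ x : M, Submodule ℝ (TangentSpace 𝓘(ℝ, E) x)) (θ : ℝ)
    (h : M ≃ₘ^1⟮𝓘(ℝ, E), 𝓘(ℝ, E)⟯ M) : Prop where
  image_eq : h '' Γ = Γ
  isCompl : ∀ x ∈ Γ, IsCompl (Es x) (Eu x)
  mem_s : ∀ x ∈ Γ, ∀ v ∈ Es x, mfderiv 𝓘(ℝ, E) 𝓘(ℝ, E) h x v ∈ Es (h x)
  mem_u : ∀ x ∈ Γ, ∀ v ∈ Eu x, mfderiv 𝓘(ℝ, E) 𝓘(ℝ, E) h x v ∈ Eu (h x)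
  contracts : ∀ x ∈ Γ, ∀ v ∈ Es x,
    metricForm g ⟨h x, mfderiv 𝓘(ℝ, E) 𝓘(ℝ, E) h x v⟩ ≤ θ * metricForm g ⟨x, v⟩
  expands : ∀ x ∈ Γ, ∀ v ∈ Eu x,
    metricForm g ⟨x, v⟩ ≤ θ * metricForm g ⟨h x, mfderiv 𝓘(ℝ, E) 𝓘(ℝ, E) h x v⟩

namespace IsSplitHyperbolic

variable {g : ContinuousRiemannianMetric E (fun x : M => TangentSpace 𝓘(ℝ, E) x)} {Γ : Set M}
  {Es Eu : ∀ x : M, Submodule ℝ (TangentSpace 𝓘(ℝ, E) x)} {θ θ' : ℝ}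
  {h k : M ≃ₘ^1⟮𝓘(ℝ, E), 𝓘(ℝ, E)⟯ M}

theorem apply_mem (hh : IsSplitHyperbolic g Γ Es Eu θ h) {x : M} (hx : x ∈ Γ) : h x ∈ Γ :=
  hh.image_eq ▸ mem_image_of_mem h hx

theorem symm_image_eq (hh : IsSplitHyperbolic g Γ Es Eu θ h) : h.symm '' Γ = Γ := by
  conv_lhs => rw [← hh.image_eq]
  rw [image_image]
  simp

/-- The unstable component of `v` is mapped into both subspaces, hence to zero, and the derivative
is injective. -/
theorem mem_s_of_mem (hh : IsSplitHyperbolic g Γ Es Eu θ h) {x : M} (hx : x ∈ Γ)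
    {v : TangentSpace 𝓘(ℝ, E) x} (hv : mfderiv 𝓘(ℝ, E) 𝓘(ℝ, E) h x v ∈ Es (h x)) : v ∈ Es x := by
  have hc := hh.isCompl x hx
  obtain ⟨s, hs, u, hu, rfl⟩ := Submodule.mem_sup.1 (hc.sup_eq_top ▸ Submodule.mem_top (x := v))
  have h1 : mfderiv 𝓘(ℝ, E) 𝓘(ℝ, E) h x u ∈ Es (h x) := by
    rw [map_add] at hv
    exact ((Es (h x)).add_mem_iff_right (hh.mem_s x hx s hs)).1 hv
  have h2 := Submodule.disjoint_def.1 (hh.isCompl _ (hh.apply_mem hx)).disjoint _ h1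
    (hh.mem_u x hx u hu)
  have h3 : u = 0 := (h.mfderivToContinuousLinearEquiv one_ne_zero x).map_eq_zero_iff.1 h2
  simpa [h3] using hs

theorem mem_u_of_mem (hh : IsSplitHyperbolic g Γ Es Eu θ h) {x : M} (hx : x ∈ Γ)
    {v : TangentSpace 𝓘(ℝ, E) x} (hv : mfderiv 𝓘(ℝ, E) 𝓘(ℝ, E) h x v ∈ Eu (h x)) : v ∈ Eu x := by
  have hc := hh.isCompl x hx
  obtain ⟨s, hs, u, hu, rfl⟩ := Submodule.mem_sup.1 (hc.sup_eq_top ▸ Submodule.mem_top (x := v))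
  have h1 : mfderiv 𝓘(ℝ, E) 𝓘(ℝ, E) h x s ∈ Eu (h x) := by
    rw [map_add] at hv
    exact ((Eu (h x)).add_mem_iff_left (hh.mem_u x hx u hu)).1 hv
  have h2 := Submodule.disjoint_def.1 (hh.isCompl _ (hh.apply_mem hx)).disjoint _
    (hh.mem_s x hx s hs) h1
  have h3 : s = 0 := (h.mfderivToContinuousLinearEquiv one_ne_zero x).map_eq_zero_iff.1 h2
  simpa [h3] using hu

/-- This symmetry lets every statement about stable spaces be used for unstable ones. -/
theorem symm (hh : IsSplitHyperbolic g Γ Es Eu θ h) : IsSplitHyperbolic g Γ Eu Es θ h.symm := by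
  have hmem : ∀ (S : ∀ x : M, Submodule ℝ (TangentSpace 𝓘(ℝ, E) x)) {p q : TangentBundle 𝓘(ℝ, E) M},
      p = q → q.2 ∈ S q.1 → p.2 ∈ S p.1 := by
    rintro S p q rfl hq
    exact hq
  have key : ∀ y ∈ Γ, ∀ v : TangentSpace 𝓘(ℝ, E) y, ∃ x ∈ Γ, ∃ w : TangentSpace 𝓘(ℝ, E) x,
      (⟨y, v⟩ : TangentBundle 𝓘(ℝ, E) M) = ⟨h x, mfderiv 𝓘(ℝ, E) 𝓘(ℝ, E) h x w⟩ ∧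
      (⟨h.symm y, mfderiv 𝓘(ℝ, E) 𝓘(ℝ, E) h.symm y v⟩ : TangentBundle 𝓘(ℝ, E) M) = ⟨x, w⟩ := by
    intro y hy v
    obtain ⟨x, hx, rfl⟩ := hh.image_eq.symm ▸ hy
    obtain ⟨w, rfl⟩ := exists_mfderiv_eq h x v
    exact ⟨x, hx, w, rfl, mfderiv_symm_mfderiv h x w⟩
  refine ⟨hh.symm_image_eq, fun x hx => (hh.isCompl x hx).symm, ?_, ?_, ?_, ?_⟩
  · intro y hy v hv
    obtain ⟨x, hx, w, h1, h2⟩ := key y hy v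
    exact hmem Eu h2 (hh.mem_u_of_mem hx (hmem Eu h1.symm hv))
  · intro y hy v hv
    obtain ⟨x, hx, w, h1, h2⟩ := key y hy v
    exact hmem Es h2 (hh.mem_s_of_mem hx (hmem Es h1.symm hv))
  · intro y hy v hv
    obtain ⟨x, hx, w, h1, h2⟩ := key y hy v
    rw [h1, h2]
    exact hh.expands x hx w (hh.mem_u_of_mem hx (hmem Eu h1.symm hv))
  · intro y hy v hv
    obtain ⟨x, hx, w, h1, h2⟩ := key y hy v
    rw [h1, h2]
    exact hh.contracts x hx w (hh.mem_s_of_mem hx (hmem Es h1.symm hv))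

theorem trans (hh : IsSplitHyperbolic g Γ Es Eu θ h) (hk : IsSplitHyperbolic g Γ Es Eu θ' k)
    (hθ : 0 ≤ θ) (hθ' : 0 ≤ θ') : IsSplitHyperbolic g Γ Es Eu (θ * θ') (h.trans k) := by
  have hd : ∀ x, mfderiv 𝓘(ℝ, E) 𝓘(ℝ, E) (h.trans k) x =
      (mfderiv 𝓘(ℝ, E) 𝓘(ℝ, E) k (h x)).comp (mfderiv 𝓘(ℝ, E) 𝓘(ℝ, E) h x) := fun x =>
    mfderiv_comp x (k.contMDiff.mdifferentiable one_ne_zero _)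
      (h.contMDiff.mdifferentiable one_ne_zero _)
  refine ⟨?_, hh.isCompl, ?_, ?_, ?_, ?_⟩
  · rw [Diffeomorph.coe_trans, image_comp, hh.image_eq, hk.image_eq]
  · intro x hx v hv
    rw [hd]
    exact hk.mem_s _ (hh.apply_mem hx) _ (hh.mem_s x hx v hv)
  · intro x hx v hv
    rw [hd]
    exact hk.mem_u _ (hh.apply_mem hx) _ (hh.mem_u x hx v hv)
  · intro x hx v hv
    rw [hd]
    have h1 := hk.contracts _ (hh.apply_mem hx) _ (hh.mem_s x hx v hv)
    have h2 := mul_le_mul_of_nonneg_left (hh.contracts x hx v hv) hθ'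
    exact h1.trans (h2.trans (le_of_eq (by ring)))
  · intro x hx v hv
    rw [hd]
    have h1 := hh.expands x hx v hv
    have h2 := mul_le_mul_of_nonneg_left (hk.expands _ (hh.apply_mem hx) _ (hh.mem_u x hx v hv)) hθ
    exact h1.trans (h2.trans (le_of_eq (by rw [← mul_assoc]; rfl)))

theorem exists_iterate (hh : IsSplitHyperbolic g Γ Es Eu θ h) (hθ : 0 ≤ θ) (n : ℕ) :
    ∃ k : M ≃ₘ^1⟮𝓘(ℝ, E), 𝓘(ℝ, E)⟯ M, (∀ x, k x = h^[n] x) ∧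
      IsSplitHyperbolic g Γ Es Eu (θ ^ (n + 1)) (k.trans h) := by
  induction n with
  | zero =>
    refine ⟨Diffeomorph.refl _ _ _, fun x => rfl, ?_⟩
    have : (Diffeomorph.refl 𝓘(ℝ, E) M 1).trans h = h := Diffeomorph.ext fun x => rfl
    rw [this]
    simpa using hh
  | succ n ih =>
    obtain ⟨k, hk, hs⟩ := ih
    refine ⟨k.trans h, fun x => ?_, ?_⟩
    · rw [Function.iterate_succ_apply', ← hk]
      rfl
    · rw [pow_succ]
      exact hs.trans hh (by positivity) hθ

/-- A nonzero unstable component would grow without bound under iteration, while the whole vector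
and its stable component do not grow. The right side mentions the subspaces at `x` only through the
choice of `k`, so it makes sense on the whole tangent bundle. -/
theorem mem_s_iff (hh : IsSplitHyperbolic g Γ Es Eu θ h) (hθ0 : 0 < θ) (hθ : θ < 1) {x : M}
    (hx : x ∈ Γ) (v : TangentSpace 𝓘(ℝ, E) x) :
    v ∈ Es x ↔ ∀ k : M ≃ₘ^1⟮𝓘(ℝ, E), 𝓘(ℝ, E)⟯ M, (∃ n, IsSplitHyperbolic g Γ Es Eu (θ ^ (n + 1))
        k) →
      metricForm g (tangentMap 𝓘(ℝ, E) 𝓘(ℝ, E) k ⟨x, v⟩) ≤ metricForm g ⟨x, v⟩ := by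
  constructor
  · rintro hv k ⟨n, hk⟩
    refine (hk.contracts x hx v hv).trans ?_
    have := pow_le_one₀ (n := n + 1) hθ0.le hθ.le
    nlinarith [metricForm_nonneg g ⟨x, v⟩]
  · intro H
    obtain ⟨s, hs, u, hu, rfl⟩ :=
      Submodule.mem_sup.1 ((hh.isCompl x hx).sup_eq_top ▸ Submodule.mem_top (x := v))
    set K := 2 * metricForm g ⟨x, s + u⟩ + 2 * metricForm g ⟨x, s⟩
    have hK : ∀ n : ℕ, metricForm g ⟨x, u⟩ ≤ θ ^ (n + 1) * K := by
      intro n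
      obtain ⟨k₀, -, hk⟩ := hh.exists_iterate hθ0.le n
      set k := k₀.trans h
      refine (hk.expands x hx u hu).trans (mul_le_mul_of_nonneg_left ?_ (by positivity))
      have h1 := metricForm_sub_le g (k x) (mfderiv 𝓘(ℝ, E) 𝓘(ℝ, E) k x (s + u))
        (mfderiv 𝓘(ℝ, E) 𝓘(ℝ, E) k x s)
      rw [← map_sub, add_sub_cancel_left] at h1
      have h2 : metricForm g ⟨k x, mfderiv 𝓘(ℝ, E) 𝓘(ℝ, E) k x (s + u)⟩ ≤ metricForm g ⟨x, s + u⟩ :=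
        H k ⟨n, hk⟩
      have h3 := hk.contracts x hx s hs
      have h4 := pow_le_one₀ (n := n + 1) hθ0.le hθ.le
      have h5 : metricForm g ⟨k x, mfderiv 𝓘(ℝ, E) 𝓘(ℝ, E) k x s⟩ ≤ metricForm g ⟨x, s⟩ := by
        nlinarith [metricForm_nonneg g ⟨x, s⟩]
      exact h1.trans (by unfold K; exact add_le_add (by linarith [h2]) (by linarith))
    have h0 : metricForm g ⟨x, u⟩ ≤ 0 := by
      refine ge_of_tendsto' (x := atTop) (f := fun n : ℕ => θ ^ (n + 1) * K) ?_ hK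
      simpa using ((tendsto_pow_atTop_nhds_zero_of_lt_one hθ0.le hθ).comp
        (tendsto_add_atTop_nat 1)).mul_const K
    have hu0 : u = 0 := by
      by_contra hne
      exact absurd (g.pos x u hne) (not_lt.2 h0)
    simpa [hu0] using hs

/-- The criterion `mem_s_iff` is an intersection of inequalities between continuous functions. -/
theorem exists_isClosed_s (hh : IsSplitHyperbolic g Γ Es Eu θ h) (hθ0 : 0 < θ) (hθ : θ < 1) :
    ∃ Z : Set (TangentBundle 𝓘(ℝ, E) M), IsClosed Z ∧
      ∀ x ∈ Γ, ∀ v : TangentSpace 𝓘(ℝ, E) x, (⟨x, v⟩ : TangentBundle 𝓘(ℝ, E) M) ∈ Z ↔ v ∈ Es x := by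
  refine ⟨⋂ (k : M ≃ₘ^1⟮𝓘(ℝ, E), 𝓘(ℝ, E)⟯ M) (_ : ∃ n, IsSplitHyperbolic g Γ Es Eu (θ ^ (n + 1)) k),
    {p | metricForm g (tangentMap 𝓘(ℝ, E) 𝓘(ℝ, E) k p) ≤ metricForm g p}, ?_, fun x hx v => ?_⟩
  · refine isClosed_iInter fun k => isClosed_iInter fun _ => isClosed_le ?_
      (continuous_metricForm g)
    exact (continuous_metricForm g).comp (k.contMDiff.continuous_tangentMap le_rfl)
  · rw [hh.mem_s_iff hθ0 hθ hx]
    simp only [mem_iInter]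
    rfl

end IsSplitHyperbolic

/-- The common rate is the worse of `μ` and `κ⁻¹`, squared because `metricForm` is a squared length.
-/
theorem IsHyperbolicSet.exists_isSplitHyperbolic {f : M ≃ₘ^1⟮𝓘(ℝ, E), 𝓘(ℝ, E)⟯ M} {Γ : Set M}
    (hΓ : f '' Γ = Γ) (hf : IsHyperbolicSet 𝓘(ℝ, E) f Γ) :
    ∃ g Es Eu, ∃ θ : ℝ, 0 < θ ∧ θ < 1 ∧ IsSplitHyperbolic g Γ Es Eu θ f := by
  obtain ⟨g, Es, Eu, μ, κ, hμ, hμ1, hκ, h⟩ := hf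
  have hsq : ∀ x (v : TangentSpace 𝓘(ℝ, E) x),
      metricNorm 𝓘(ℝ, E) g v ^ 2 = metricForm g ⟨x, v⟩ := fun x v =>
    Real.sq_sqrt (metricForm_nonneg g ⟨x, v⟩)
  have hn : ∀ x (v : TangentSpace 𝓘(ℝ, E) x), 0 ≤ metricNorm 𝓘(ℝ, E) g v := fun x v =>
    Real.sqrt_nonneg _
  refine ⟨g, Es, Eu, max μ κ⁻¹ ^ 2, by positivity, ?_, hΓ, fun x hx => (h x hx).1, ?_, ?_, ?_, ?_⟩
  · exact pow_lt_one₀ (by positivity) (max_lt hμ1 (inv_lt_one_of_one_lt₀ hκ)) two_ne_zero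
  · intro x hx v hv
    rw [← (h x hx).2.1]
    exact Submodule.mem_map_of_mem hv
  · intro x hx v hv
    rw [← (h x hx).2.2.1]
    exact Submodule.mem_map_of_mem hv
  · intro x hx v hv
    rw [← hsq, ← hsq, ← mul_pow]
    refine pow_le_pow_left₀ (hn _ _) (((h x hx).2.2.2.1 v hv).trans ?_) 2
    exact mul_le_mul_of_nonneg_right (le_max_left _ _) (hn _ _)
  · intro x hx v hv
    rw [← hsq, ← hsq, ← mul_pow]
    refine pow_le_pow_left₀ (hn _ _) (le_trans ?_
      (mul_le_mul_of_nonneg_right (le_max_right _ _) (hn _ _))) 2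
    rw [inv_mul_eq_div, le_div_iff₀ (by linarith), mul_comm]
    exact (h x hx).2.2.2.2 v hv

end SplitHyperbolic

/-! ### Derivatives in charts -/

section TangentCoordinates

variable {E : Type*} [NormedAddCommGroup E] [NormedSpace ℝ E]
  {M : Type*} [TopologicalSpace M] [ChartedSpace E M]

theorem isOpen_chartAt_comp_domain (h : M ≃ₘ^1⟮𝓘(ℝ, E), 𝓘(ℝ, E)⟯ M) (c c' : M) :
    IsOpen ((chartAt E c).target ∩ (chartAt E c).symm ⁻¹' (h ⁻¹' (chartAt E c').source)) :=
  (chartAt E c).symm.isOpen_inter_preimage ((chartAt E c').open_source.preimage h.continuous)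

variable [IsManifold 𝓘(ℝ, E) 1 M]

/-- The derivative at `y` of the chart centred at `c`. -/
def chartEquiv (c y : M) (hy : y ∈ (chartAt E c).source) : TangentSpace 𝓘(ℝ, E) y ≃L[ℝ] E :=
  (trivializationAt E (TangentSpace 𝓘(ℝ, E)) c).continuousLinearEquivAt ℝ y hy

theorem continuous_chartEquiv_symm (c : M) :
    Continuous fun p : (chartAt E c).source × E =>
      (⟨p.1, (chartEquiv c p.1 p.1.2).symm p.2⟩ : TangentBundle 𝓘(ℝ, E) M) := by
  have h := (trivializationAt E (TangentSpace 𝓘(ℝ, E)) c).continuousOn_symm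
  have h2 : Continuous fun p : (chartAt E c).source × E => ((p.1 : M), p.2) := by fun_prop
  refine (h.comp_continuous h2 fun p => ⟨p.1.2, mem_univ _⟩).congr fun p => ?_
  rfl

theorem hasMFDerivAt_chartAt (c y : M) (hy : y ∈ (chartAt E c).source) :
    HasMFDerivAt 𝓘(ℝ, E) 𝓘(ℝ, E) (chartAt E c) y (chartEquiv c y hy : TangentSpace 𝓘(ℝ,
        E) y →L[ℝ] E) := by
  have h1 := (mdifferentiableAt_extChartAt (I := 𝓘(ℝ, E)) hy).hasMFDerivAt
  rw [← TangentBundle.continuousLinearMapAt_trivializationAt hy] at h1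
  have h2 : (chartEquiv c y hy : TangentSpace 𝓘(ℝ, E) y →L[ℝ] E) =
      (trivializationAt E (TangentSpace 𝓘(ℝ, E)) c).continuousLinearMapAt ℝ y :=
    Bundle.Trivialization.coe_continuousLinearEquivAt_eq' _ hy
  rw [h2]
  simpa using! h1

theorem hasMFDerivAt_chartAt_symm (c y : M) (hy : y ∈ (chartAt E c).source) :
    HasMFDerivAt 𝓘(ℝ, E) 𝓘(ℝ, E) (chartAt E c).symm (chartAt E c y)
      ((chartEquiv c y hy).symm : E →L[ℝ] TangentSpace 𝓘(ℝ, E) y) := by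
  have h1 : MDifferentiableAt 𝓘(ℝ, E) 𝓘(ℝ, E) (chartAt E c).symm (chartAt E c y) :=
    mdifferentiableAt_atlas_symm (chart_mem_atlas E c) ((chartAt E c).map_source hy)
  have h2 := TangentBundle.symmL_trivializationAt (𝕜 := ℝ) (I := 𝓘(ℝ, E)) hy
  have h3 : ((chartEquiv c y hy).symm : E →L[ℝ] TangentSpace 𝓘(ℝ, E) y) =
      (trivializationAt E (TangentSpace 𝓘(ℝ, E)) c).symmL ℝ y :=
    Bundle.Trivialization.symm_continuousLinearEquivAt_eq' _ hy
  rw [h3, h2]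
  have h4 := h1.hasMFDerivAt
  simp only [modelWithCornersSelf_coe, range_id, mfderivWithin_univ]
  simpa using! h4

theorem hasFDerivAt_chartAt_comp (h : M ≃ₘ^1⟮𝓘(ℝ, E), 𝓘(ℝ, E)⟯ M) {c c' y : M}
    (hy : y ∈ (chartAt E c).source) (hy' : h y ∈ (chartAt E c').source) :
    HasFDerivAt (fun v => chartAt E c' (h ((chartAt E c).symm v)))
      ((chartEquiv c' (h y) hy' : TangentSpace 𝓘(ℝ, E) (h y) →L[ℝ] E).comp
        ((mfderiv 𝓘(ℝ, E) 𝓘(ℝ, E) h y).comp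
          ((chartEquiv c y hy).symm : E →L[ℝ] TangentSpace 𝓘(ℝ, E) y)))
      (chartAt E c y) := by
  have e : (chartAt E c).symm (chartAt E c y) = y := (chartAt E c).left_inv hy
  have h1 := hasMFDerivAt_chartAt_symm c y hy
  have h2 := (h.contMDiff.mdifferentiable one_ne_zero y).hasMFDerivAt
  have h3 := hasMFDerivAt_chartAt c' (h y) hy'
  have key : ∀ z, z = y → HasMFDerivAt 𝓘(ℝ, E) 𝓘(ℝ, E) (chartAt E c' ∘ h) z
      (((chartEquiv c' (h y) hy' : TangentSpace 𝓘(ℝ, E) (h y) →L[ℝ] E).comp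
        (mfderiv 𝓘(ℝ, E) 𝓘(ℝ, E) h y) : TangentSpace 𝓘(ℝ, E) y →L[ℝ] E) : E →L[ℝ] E) := by
    rintro z rfl
    exact h3.comp z h2
  exact hasMFDerivAt_iff_hasFDerivAt.1 ((key _ e).comp _ h1)

theorem contDiffOn_chartAt_comp (h : M ≃ₘ^1⟮𝓘(ℝ, E), 𝓘(ℝ, E)⟯ M) (c c' : M) :
    ContDiffOn ℝ 1 (fun v => chartAt E c' (h ((chartAt E c).symm v)))
      ((chartAt E c).target ∩ (chartAt E c).symm ⁻¹' (h ⁻¹' (chartAt E c').source)) := by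
  rw [← contMDiffOn_iff_contDiffOn]
  have h1 := contMDiffOn_chart (I := 𝓘(ℝ, E)) (n := 1) (x := c')
  have h2 := contMDiffOn_chart_symm (I := 𝓘(ℝ, E)) (n := 1) (x := c)
  exact h1.comp (h.contMDiff.comp_contMDiffOn (h2.mono inter_subset_left)) fun v hv => hv.2

end TangentCoordinates

/-! ### The splitting and the metric in charts -/

section SplittingCoordinates

variable {E : Type*} [NormedAddCommGroup E] [NormedSpace ℝ E]
  {M : Type*} [TopologicalSpace M] [ChartedSpace E M] [IsManifold 𝓘(ℝ, E) 1 M]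
  {g : ContinuousRiemannianMetric E (fun x : M => TangentSpace 𝓘(ℝ, E) x)}

variable {Γ : Set M} {Es Eu : ∀ x : M, Submodule ℝ (TangentSpace 𝓘(ℝ, E) x)} {θ : ℝ}
  {h : M ≃ₘ^1⟮𝓘(ℝ, E), 𝓘(ℝ, E)⟯ M}

/-- The linear part of a hyperbolic step, in charts. -/
theorem IsSplitHyperbolic.chart_estimates (hh : IsSplitHyperbolic g Γ Es Eu θ h)
    (hθ : 0 ≤ θ) {c c' y : M} (hy : y ∈ Γ)
    (hyc : y ∈ (chartAt E c).source) (hyc' : h y ∈ (chartAt E c').source) {C D : ℝ} (hC : 0 ≤ C)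
    (hθC : θ * C ^ 2 * (1 + D) ^ 2 ≤ 1 / 64)
    (hC₁ : ∀ v, metricForm g ⟨y, (chartEquiv c y hyc).symm v⟩ ≤ C * ‖v‖ ^ 2 ∧
      ‖v‖ ^ 2 ≤ C * metricForm g ⟨y, (chartEquiv c y hyc).symm v⟩)
    (hC₂ : ∀ v, metricForm g ⟨h y, (chartEquiv c' (h y) hyc').symm v⟩ ≤ C * ‖v‖ ^ 2 ∧
      ‖v‖ ^ 2 ≤ C * metricForm g ⟨h y, (chartEquiv c' (h y) hyc').symm v⟩)
    {P P' : E →L[ℝ] E}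
    (hP : ∀ v, (chartEquiv c y hyc).symm (P v) ∈ Es y ∧ (chartEquiv c y hyc).symm (v - P v) ∈ Eu y)
    (hP' : ∀ v, (chartEquiv c' (h y) hyc').symm (P' v) ∈ Es (h y) ∧
      (chartEquiv c' (h y) hyc').symm (v - P' v) ∈ Eu (h y))
    (hPD : ‖P‖ ≤ D) (hPD' : ‖P'‖ ≤ D) :
    ∃ A : E ≃L[ℝ] E,
      (A : E →L[ℝ] E) = (chartEquiv c' (h y) hyc' : TangentSpace 𝓘(ℝ, E) (h y) →L[ℝ] E).comp
        ((mfderiv 𝓘(ℝ, E) 𝓘(ℝ, E) h y).comp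
          ((chartEquiv c y hyc).symm : E →L[ℝ] TangentSpace 𝓘(ℝ, E) y)) ∧
      (∀ v, P' (P' v) = P' v) ∧ (∀ v, A (P v) = P' (A v)) ∧
      (∀ v, ‖A (P v)‖ ≤ ‖v‖ / 8) ∧ (∀ v, ‖A.symm (v - P' v)‖ ≤ ‖v‖ / 8) := by
  let A : E ≃L[ℝ] E := (chartEquiv c y hyc).symm.trans
    ((h.mfderivToContinuousLinearEquiv one_ne_zero y).trans (chartEquiv c' (h y) hyc'))
  set T := chartEquiv c y hyc
  set T' := chartEquiv c' (h y) hyc'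
  have hA : ∀ v, T'.symm (A v) = mfderiv 𝓘(ℝ, E) 𝓘(ℝ, E) h y (T.symm v) := fun v =>
    T'.symm_apply_apply _
  have huniq : ∀ v s, T'.symm s ∈ Es (h y) → T'.symm (v - s) ∈ Eu (h y) → P' v = s := by
    intro v s h1 h2
    have h3 : T'.symm (P' v - s) ∈ Es (h y) := by
      rw [map_sub]; exact Submodule.sub_mem _ (hP' v).1 h1
    have h4 : T'.symm (P' v - s) ∈ Eu (h y) := by
      have := Submodule.sub_mem _ h2 (hP' v).2
      rwa [← map_sub, sub_sub_sub_cancel_left] at this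
    have h5 := Submodule.disjoint_def.1 (hh.isCompl _ (hh.apply_mem hy)).disjoint _ h3 h4
    exact sub_eq_zero.1 (T'.symm.map_eq_zero_iff.1 h5)
  -- Passing from the norm to the metric and back costs `C ^ 2`, and projecting costs at most `(1 +
  -- D) ^ 2` in squared length. The bound 1/64 on the product is the square of the required 1/8.
  have hsq : ∀ a b : ℝ, ∀ v : E, 0 ≤ a → a ^ 2 ≤ C * (θ * (C * b ^ 2)) → b ≤ (1 + D) * ‖v‖ → 0 ≤ b →
      a ≤ ‖v‖ / 8 := by
    intro a b v ha h1 h2 h3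
    refine le_of_sq_le_sq ?_ (by positivity)
    have h4 : b ^ 2 ≤ ((1 + D) * ‖v‖) ^ 2 := pow_le_pow_left₀ h3 h2 2
    have h5 : C * (θ * (C * b ^ 2)) ≤ C * (θ * (C * ((1 + D) * ‖v‖) ^ 2)) := by gcongr
    have h6 := mul_le_mul_of_nonneg_right hθC (sq_nonneg ‖v‖)
    nlinarith
  refine ⟨A, rfl, fun v => ?_, fun v => ?_, fun v => ?_, fun v => ?_⟩
  · exact huniq _ _ (hP' v).1 (by rw [sub_self, map_zero]; exact Submodule.zero_mem _)
  · refine (huniq _ _ ?_ ?_).symm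
    · rw [hA]
      exact hh.mem_s y hy _ (hP v).1
    · rw [← map_sub, hA]
      exact hh.mem_u y hy _ (hP v).2
  · refine hsq _ ‖P v‖ v (norm_nonneg _) ?_ ?_ (norm_nonneg _)
    · refine ((hC₂ _).2).trans (mul_le_mul_of_nonneg_left ?_ hC)
      rw [hA]
      exact (hh.contracts y hy _ (hP v).1).trans (mul_le_mul_of_nonneg_left (hC₁ _).1 hθ)
    · exact (P.le_of_opNorm_le hPD v).trans (by nlinarith [norm_nonneg v])
  · refine hsq _ ‖v - P' v‖ v (norm_nonneg _) ?_ ?_ (norm_nonneg _)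
    · refine ((hC₁ _).2).trans (mul_le_mul_of_nonneg_left ?_ hC)
      have h1 : mfderiv 𝓘(ℝ, E) 𝓘(ℝ, E) h y (T.symm (A.symm (v - P' v))) = T'.symm (v - P' v) := by
        rw [← hA, A.apply_symm_apply]
      have h2 : T.symm (A.symm (v - P' v)) ∈ Eu y :=
        hh.mem_u_of_mem hy (by rw [h1]; exact (hP' v).2)
      refine (hh.expands y hy _ h2).trans (mul_le_mul_of_nonneg_left ?_ hθ)
      rw [h1]
      exact (hC₂ _).1
    · have := P'.le_of_opNorm_le hPD' v
      exact (norm_sub_le _ _).trans (by linarith)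

variable [FiniteDimensional ℝ E]

/-- Compactness of `K` times the unit sphere, where the form is continuous and positive, then
homogeneity of degree two. -/
theorem exists_metricForm_comparison
    (g : ContinuousRiemannianMetric E (fun x : M => TangentSpace 𝓘(ℝ, E) x)) (c : M) {K : Set M}
    (hK : IsCompact K) (hKc : K ⊆ (chartAt E c).source) :
    ∃ C : ℝ, ∀ y (hy : y ∈ K) (v : E),
      metricForm g ⟨y, (chartEquiv c y (hKc hy)).symm v⟩ ≤ C * ‖v‖ ^ 2 ∧
      ‖v‖ ^ 2 ≤ C * metricForm g ⟨y, (chartEquiv c y (hKc hy)).symm v⟩ := by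
  let φ : (chartAt E c).source × E → ℝ := fun p =>
    metricForm g ⟨p.1, (chartEquiv c p.1 p.1.2).symm p.2⟩
  have hφ : Continuous φ := (continuous_metricForm g).comp (continuous_chartEquiv_symm c)
  have hK' : IsCompact ((Subtype.val ⁻¹' K : Set (chartAt E c).source) ×ˢ Metric.sphere (0 : E)
      1) := by
    refine IsCompact.prod ?_ (isCompact_sphere _ _)
    rw [Subtype.isCompact_iff, Subtype.image_preimage_coe, inter_eq_right.2 hKc]
    exact hK
  have hpos : ∀ p ∈ (Subtype.val ⁻¹' K : Set (chartAt E c).source) ×ˢ Metric.sphere (0 : E) 1,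
      0 < φ p := by
    rintro ⟨y, v⟩ ⟨-, hv⟩
    refine g.pos _ _ fun h0 => ?_
    have hv0 : v = 0 := (chartEquiv c y y.2).symm.map_eq_zero_iff.1 h0
    simp [hv0] at hv
  obtain ⟨C₁, h₁⟩ := hK'.exists_bound_of_continuousOn hφ.continuousOn
  obtain ⟨C₂, h₂⟩ := hK'.exists_bound_of_continuousOn
    (hφ.continuousOn.inv₀ fun p hp => (hpos p hp).ne')
  have hscale : ∀ y (hy : y ∈ K) (r : ℝ) (v : E),
      φ (⟨y, hKc hy⟩, r • v) = r ^ 2 * φ (⟨y, hKc hy⟩, v) := by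
    intro y hy r v
    change g.inner y ((chartEquiv c y _).symm (r • v)) ((chartEquiv c y _).symm (r • v)) = _
    rw [map_smul, map_smul, map_smul, smul_apply, smul_eq_mul, smul_eq_mul, ← mul_assoc, ← sq]
    rfl
  refine ⟨max C₁ C₂, fun y hy v => ?_⟩
  change φ (⟨y, hKc hy⟩, v) ≤ _ ∧ _ ≤ _ * φ (⟨y, hKc hy⟩, v)
  rcases eq_or_ne v 0 with rfl | hv
  · have h0 : φ (⟨y, hKc hy⟩, 0) = 0 := by
      have := hscale y hy 0 0
      rw [zero_smul] at this
      linarith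
    rw [h0]
    simp
  · have hn : 0 < ‖v‖ := norm_pos_iff.2 hv
    have hu : (‖v‖⁻¹ • v) ∈ Metric.sphere (0 : E) 1 := by
      rw [mem_sphere_zero_iff_norm, norm_smul, norm_inv, norm_norm, inv_mul_cancel₀ hn.ne']
    have hp : ((⟨y, hKc hy⟩, ‖v‖⁻¹ • v) : (chartAt E c).source × E) ∈
        (Subtype.val ⁻¹' K : Set (chartAt E c).source) ×ˢ Metric.sphere (0 : E) 1 := ⟨hy, hu⟩
    have e : φ (⟨y, hKc hy⟩, v) = ‖v‖ ^ 2 * φ (⟨y, hKc hy⟩, ‖v‖⁻¹ • v) := by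
      rw [← hscale y hy, smul_inv_smul₀ hn.ne']
    have b0 := hpos _ hp
    have b1 := (le_abs_self _).trans ((h₁ _ hp).trans (le_max_left C₁ C₂))
    have b2 := (le_abs_self _).trans ((h₂ _ hp).trans (le_max_right C₁ C₂))
    rw [e]
    constructor
    · rw [mul_comm]
      exact mul_le_mul_of_nonneg_right b1 (by positivity)
    · rw [Pi.inv_apply, inv_le_iff_one_le_mul₀ b0] at b2
      nlinarith [sq_nonneg ‖v‖]

/-- Closedness of the stable spaces, applied to `h` and to `h.symm`, feeds
`continuous_projection_of_isClosed`. -/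
theorem IsSplitHyperbolic.exists_continuousOn_projection [FirstCountableTopology M]
    (hh : IsSplitHyperbolic g Γ Es Eu θ h) (hθ0 : 0 < θ) (hθ : θ < 1) (c : M) :
    ∃ P : M → E →L[ℝ] E, ContinuousOn P (Γ ∩ (chartAt E c).source) ∧
      ∀ y (_ : y ∈ Γ) (hyc : y ∈ (chartAt E c).source) (v : E),
        (chartEquiv c y hyc).symm (P y v) ∈ Es y ∧ (chartEquiv c y hyc).symm (v - P y v) ∈ Eu y
            := by
  have hex : ∀ y : M, ∃ P : E →L[ℝ] E, ∀ (_ : y ∈ Γ) (hyc : y ∈ (chartAt E c).source) (v : E),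
      (chartEquiv c y hyc).symm (P v) ∈ Es y ∧ (chartEquiv c y hyc).symm (v - P v) ∈ Eu y := by
    intro y
    by_cases hy : y ∈ Γ ∧ y ∈ (chartAt E c).source
    · have hc := (Submodule.orderIsoMapComap (chartEquiv c y hy.2).toLinearEquiv).isCompl
        (hh.isCompl y hy.1)
      obtain ⟨P, h1, h2⟩ := exists_projection_of_isCompl hc
      refine ⟨P, fun _ hyc v => ⟨?_, ?_⟩⟩
      · have := h1 v
        rwa [Submodule.orderIsoMapComap_apply'] at this
      · have := h2 v
        rwa [Submodule.orderIsoMapComap_apply'] at this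
    · exact ⟨0, fun h1 h2 => absurd ⟨h1, h2⟩ hy⟩
  choose P hP using hex
  refine ⟨P, ?_, hP⟩
  rw [continuousOn_iff_continuous_domRestrict]
  let X := (Γ ∩ (chartAt E c).source : Set M)
  have hcont : Continuous fun p : X × E =>
      (⟨p.1, (chartEquiv c p.1 p.1.2.2).symm p.2⟩ : TangentBundle 𝓘(ℝ, E) M) :=
    (continuous_chartEquiv_symm c).comp
      (f := fun p : X × E => ((⟨p.1, p.1.2.2⟩ : (chartAt E c).source), p.2)) (by fun_prop)
  have hclosed : ∀ {S U : ∀ x : M, Submodule ℝ (TangentSpace 𝓘(ℝ, E) x)} {k},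
      IsSplitHyperbolic g Γ S U θ k → IsClosed {p : X × E |
        p.2 ∈ (S p.1).comap ((chartEquiv c p.1 p.1.2.2).symm : E →ₗ[ℝ] TangentSpace 𝓘(ℝ,
            E) p.1.1)} := by
    intro S U k hk
    obtain ⟨Z, hZ, hZS⟩ := hk.exists_isClosed_s hθ0 hθ
    convert hZ.preimage hcont using 1
    ext p
    exact (hZS p.1 p.1.2.1 _).symm
  refine continuous_projection_of_isClosed
    (Es := fun x : X => (Es x).comap ((chartEquiv c x x.2.2).symm : E →ₗ[ℝ] TangentSpace 𝓘(ℝ,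
        E) x.1))
    (Eu := fun x : X => (Eu x).comap ((chartEquiv c x x.2.2).symm : E →ₗ[ℝ] TangentSpace 𝓘(ℝ,
        E) x.1))
    (fun x => ?_) (hclosed hh) (hclosed hh.symm)
    (fun x v => (hP x x.2.1 x.2.2 v).1) (fun x v => (hP x x.2.1 x.2.2 v).2)
  rw [Submodule.disjoint_def]
  intro v h1 h2
  exact (chartEquiv c x x.2.2).symm.map_eq_zero_iff.1
    (Submodule.disjoint_def.1 (hh.isCompl x x.2.1).disjoint _ h1 h2)

end SplittingCoordinates

/-! ### Uniform hyperbolic coordinates and shadowing near `Γ` -/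

section Coordinates

variable {E : Type*} [NormedAddCommGroup E] [NormedSpace ℝ E] {M : Type*} [EMetricSpace M]

/-- Used to make radii uniform over finitely many charts, in `ℝ` for vectors and in `ℝ≥0∞` for
distances. -/
theorem exists_pos_forall_mem_finset {ι α : Type*} [LinearOrder α] [Zero α] [Nontrivial α]
    (hα : ∃ a : α, 0 < a) (t : Finset ι)
    {p : ι → α → Prop} (hmono : ∀ c ρ ρ', ρ' ≤ ρ → p c ρ → p c ρ')
    (h : ∀ c ∈ t, ∃ ρ > 0, p c ρ) : ∃ ρ > 0, ∀ c ∈ t, p c ρ := by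
  classical
  induction t using Finset.induction_on with
  | empty =>
    obtain ⟨a, ha⟩ := hα
    exact ⟨a, ha, by simp⟩
  | insert a s _ ih =>
    obtain ⟨ρ₁, h₁, H₁⟩ := h a (Finset.mem_insert_self _ _)
    obtain ⟨ρ₂, h₂, H₂⟩ := ih fun c hc => h c (Finset.mem_insert_of_mem hc)
    refine ⟨min ρ₁ ρ₂, lt_min h₁ h₂, fun c hc => ?_⟩
    rcases Finset.mem_insert.1 hc with rfl | hc
    · exact hmono _ _ _ (min_le_left _ _) H₁
    · exact hmono _ _ _ (min_le_right _ _) (H₂ c hc)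

/-- Charts `ψ y` around the points `y ∈ Γ`, of uniform size and distortion, in which `h` acts by
hyperbolic steps with respect to the projections `P y`. -/
structure HyperbolicCoordinates (Γ : Set M) (h : M → M) (C : ℝ) (ψ : M → OpenPartialHomeomorph M E)
    (P : M → E →L[ℝ] E) : Prop where
  nonneg : 0 ≤ C
  small_of_near : ∀ ρ > 0, ∃ δ > 0, ∀ y ∈ Γ, ∀ z, edist z y < δ →
    z ∈ (ψ y).source ∧ ‖ψ y z - ψ y y‖ < ρ
  near_of_small : ∀ η > 0, ∃ ρ > 0, ∀ y ∈ Γ, ∀ v, ‖v‖ ≤ ρ →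
    ψ y y + v ∈ (ψ y).target ∧ edist ((ψ y).symm (ψ y y + v)) y < η
  step : ∀ ε > 0, ∃ δ > 0, ∃ ρ > 0, ∀ y ∈ Γ, ∀ z ∈ Γ, edist (h y) z < δ →
    (∀ v, ‖v‖ ≤ ρ → h ((ψ y).symm (ψ y y + v)) ∈ (ψ z).source) ∧
    IsHyperbolicStep C ε ρ (P y) (P z) fun v => ψ z (h ((ψ y).symm (ψ y y + v))) - ψ z z

theorem IsHyperbolicStep.mono {C ε ρ ρ' : ℝ} {P₀ P₁ : E →L[ℝ] E} {F : E → E}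
    (h : IsHyperbolicStep C ε ρ P₀ P₁ F) (hρ : ρ' ≤ ρ) : IsHyperbolicStep C ε ρ' P₀ P₁ F := by
  obtain ⟨A, P', h1, h2, h3, h4, h5, h6, h7⟩ := h
  exact ⟨A, P', h1, h2, h3, h4, h5, h6, fun v w hv hw => h7 v w (hv.trans hρ) (hw.trans hρ)⟩

namespace HyperbolicCoordinates

variable {Γ : Set M} {h : M → M} {C : ℝ} {ψ : M → OpenPartialHomeomorph M E} {P : M → E →L[ℝ] E}

theorem mem_source (H : HyperbolicCoordinates Γ h C ψ P) {y : M} (hy : y ∈ Γ) : y ∈ (ψ y).source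
    := by
  obtain ⟨δ, hδ, h1⟩ := H.small_of_near 1 one_pos
  exact (h1 y hy y (by simpa using hδ)).1

/-- Pseudo-orbits in `Γ` are shadowed by orbits. -/
theorem exists_shadowing [CompleteSpace E] (H : HyperbolicCoordinates Γ h C ψ P) {η : ℝ≥0∞}
    (hη : 0 < η) :
    ∃ δ > 0, ∀ y : ℤ → M, (∀ n, y n ∈ Γ) → (∀ n, edist (h (y n)) (y (n + 1)) < δ) →
      ∃ q : ℤ → M, (∀ n, q (n + 1) = h (q n)) ∧ ∀ n, edist (q n) (y n) < η := by
  have hC := H.nonneg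
  set ε : ℝ := 1 / (4 * (C + 2))
  have hε : 0 < ε := by positivity
  have hCε : ε * (C + 2) ≤ 1 / 4 := by
    unfold ε
    apply le_of_eq
    field_simp
  obtain ⟨δ₁, hδ₁, ρ₁, hρ₁, h₁⟩ := H.step ε hε
  obtain ⟨ρ₂, hρ₂, h₂⟩ := H.near_of_small η hη
  set ρ := min ρ₁ ρ₂
  have hρ : 0 < ρ := lt_min hρ₁ hρ₂
  -- The jump of the pseudo-orbit, read in the chart at `y (n + 1)`, is the value of the step at
  -- zero; this radius is what the fixed point argument requires of it.
  obtain ⟨δ₂, hδ₂, h₃⟩ := H.small_of_near (ρ / 2 / (C + 1)) (by positivity)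
  refine ⟨min δ₁ δ₂, lt_min hδ₁ hδ₂, fun y hy hyo => ?_⟩
  have hstep := fun n => h₁ (y n) (hy n) (y (n + 1)) (hy _) ((hyo n).trans_le (min_le_left _ _))
  have hsmall := fun n => h₃ (y (n + 1)) (hy _) (h (y n)) ((hyo n).trans_le (min_le_right _ _))
  obtain ⟨v, hv, hvo⟩ := exists_orbit_of_isHyperbolicStep (P := fun n => P (y n)) hε.le hC hCε hρ.le
    (fun n => (hstep n).2.mono (min_le_left _ _)) (fun n => by
      have := (hsmall n).2.le
      rw [le_div_iff₀ (by linarith), mul_comm] at this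
      rwa [add_zero, (ψ (y n)).left_inv (H.mem_source (hy n))])
  refine ⟨fun n => (ψ (y n)).symm (ψ (y n) (y n) + v n), fun n => ?_, fun n =>
    (h₂ (y n) (hy n) (v n) ((hv n).trans (min_le_right _ _))).2⟩
  dsimp only
  rw [hvo n, add_sub_cancel]
  exact (ψ _).left_inv ((hstep n).1 _ ((hv n).trans (min_le_left _ _)))

/-- Orbits that stay close to an orbit in `Γ` coincide with it. -/
theorem exists_expansivity (H : HyperbolicCoordinates Γ h C ψ P) :
    ∃ η > 0, ∀ y q : ℤ → M, (∀ n, y n ∈ Γ) → (∀ n, y (n + 1) = h (y n)) →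
      (∀ n, q (n + 1) = h (q n)) → (∀ n, edist (q n) (y n) < η) → q = y := by
  have hC := H.nonneg
  set ε : ℝ := 1 / (4 * (C + 2))
  have hε : 0 < ε := by positivity
  have hCε : ε * (C + 2) ≤ 1 / 4 := by
    unfold ε
    apply le_of_eq
    field_simp
  obtain ⟨δ₁, hδ₁, ρ₁, hρ₁, h₁⟩ := H.step ε hε
  obtain ⟨δ₂, hδ₂, h₂⟩ := H.small_of_near ρ₁ hρ₁
  refine ⟨δ₂, hδ₂, fun y q hy hyo hqo hq => ?_⟩
  have hstep := fun n => h₁ (y n) (hy n) (y (n + 1)) (hy _) (by rw [hyo n, edist_self]; exact hδ₁)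
  have hsrc := fun n => h₂ (y n) (hy n) (q n) (hq n)
  have heq : ∀ n, (ψ (y n)).symm (ψ (y n) (y n) + (ψ (y n) (q n) - ψ (y n) (y n))) = q n := by
    intro n
    rw [add_sub_cancel]
    exact (ψ (y n)).left_inv (hsrc n).1
  -- In coordinates centred along `y`, the orbit `y` itself is the zero sequence.
  have := orbit_unique_of_isHyperbolicStep (P := fun n => P (y n)) hε.le hC hCε
    (fun n => (hstep n).2) (v := fun n => ψ (y n) (q n) - ψ (y n) (y n)) (w := fun _ => 0)
    (fun n => (hsrc n).2.le) (fun n => by simpa using hρ₁.le)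
    (fun n => by rw [heq, hqo n])
    (fun n => by rw [add_zero, (ψ (y n)).left_inv (H.mem_source (hy n)), ← hyo n, sub_self])
  funext n
  exact (ψ (y n)).injOn (hsrc n).1 (H.mem_source (hy n)) (sub_eq_zero.1 (congrFun this n))

end HyperbolicCoordinates

/-- The Lebesgue number keeps a whole ball of uniform size around each point of `Γ` inside one
compact piece of one chart. -/
theorem exists_chart_cover (E : Type*) [NormedAddCommGroup E] [NormedSpace ℝ E]
    [FiniteDimensional ℝ E] [ChartedSpace E M] {Γ : Set M} (hΓ : IsCompact Γ) :
    ∃ (t : Finset M) (K : M → Set M) (δ : ℝ≥0∞), 0 < δ ∧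
      (∀ c, IsCompact (K c) ∧ K c ⊆ (chartAt E c).source) ∧
      ∀ y ∈ Γ, ∃ c ∈ t, ∀ z, edist z y < δ → z ∈ K c := by
  have : LocallyCompactSpace M := ChartedSpace.locallyCompactSpace E M
  choose K hK using fun c : M => exists_compact_subset (chartAt E c).open_source
      (mem_chart_source E c)
  obtain ⟨t, -, ht⟩ := hΓ.elim_nhds_subcover (fun c => interior (K c))
    fun c _ => isOpen_interior.mem_nhds (hK c).2.1
  obtain ⟨δ, hδ, h⟩ := lebesgue_number_lemma_of_emetric (c := fun c : t => interior (K c)) hΓ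
    (fun _ => isOpen_interior) (by simpa [iUnion_subtype] using ht)
  refine ⟨t, K, δ, hδ, fun c => ⟨(hK c).1, (hK c).2.2⟩, fun y hy => ?_⟩
  obtain ⟨c, hc⟩ := h y hy
  exact ⟨c, c.2, fun z hz => interior_subset (hc hz)⟩

variable [ChartedSpace E M] [IsManifold 𝓘(ℝ, E) 1 M] [FiniteDimensional ℝ E]

/-- Finitely many charts give uniform distortion constants, and a high iterate of `f` contracts
strongly enough to absorb them. Hence the coordinates are for an iterate rather than for `f`. -/
theorem IsSplitHyperbolic.exists_hyperbolicCoordinates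
    {g : ContinuousRiemannianMetric E (fun x : M => TangentSpace 𝓘(ℝ, E) x)} {Γ : Set M}
    {Es Eu : ∀ x : M, Submodule ℝ (TangentSpace 𝓘(ℝ, E) x)} {θ : ℝ}
    {f : M ≃ₘ^1⟮𝓘(ℝ, E), 𝓘(ℝ, E)⟯ M} (hf : IsSplitHyperbolic g Γ Es Eu θ f)
    (hθ0 : 0 < θ) (hθ : θ < 1) (hΓ : IsCompact Γ) :
    ∃ (N : ℕ) (C : ℝ) (ψ : M → OpenPartialHomeomorph M E) (P : M → E →L[ℝ] E),
      HyperbolicCoordinates Γ f^[N + 1] C ψ P := by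
  obtain ⟨t, L, δ₀, hδ₀, hL, hi⟩ := exists_chart_cover E hΓ
  have hi' : ∀ y, ∃ c, y ∈ Γ → c ∈ t ∧ ∀ z, edist z y < δ₀ → z ∈ L c := by
    intro y
    by_cases hy : y ∈ Γ
    · obtain ⟨c, hc⟩ := hi y hy
      exact ⟨c, fun _ => hc⟩
    · exact ⟨y, fun h => absurd h hy⟩
  choose i hit hiL using hi'
  have hself : ∀ y ∈ Γ, y ∈ L (i y) := fun y hy => hiL y hy y (by simpa using hδ₀)
  let K : M → Set M := fun c => Γ ∩ L c
  have hK : ∀ c, IsCompact (K c) := fun c => hΓ.inter (hL c).1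
  have hKc : ∀ c, K c ⊆ (chartAt E c).source := fun c => inter_subset_right.trans (hL c).2
  have hself' : ∀ y ∈ Γ, y ∈ K (i y) := fun y hy => ⟨hy, hself y hy⟩
  choose C₀ hC₀ using fun c => exists_metricForm_comparison g c (hK c) (hKc c)
  choose P hPc hP using fun c => hf.exists_continuousOn_projection hθ0 hθ c
  have hPK : ∀ c, ContinuousOn (P c) (K c) := fun c =>
    (hPc c).mono (subset_inter inter_subset_left (hKc c))
  choose D₀ hD₀ using fun c => (hK c).exists_bound_of_continuousOn (hPK c)
  obtain ⟨C₁, hC₁⟩ := (t.image C₀).exists_le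
  obtain ⟨D₁, hD₁⟩ := (t.image D₀).exists_le
  set C := max C₁ 0
  set D := max D₁ 0
  have hC0 : 0 ≤ C := le_max_right _ _
  have hD0 : 0 ≤ D := le_max_right _ _
  have hC : ∀ c ∈ t, ∀ y (hy : y ∈ K c) (v : E),
      metricForm g ⟨y, (chartEquiv c y (hKc c hy)).symm v⟩ ≤ C * ‖v‖ ^ 2 ∧
      ‖v‖ ^ 2 ≤ C * metricForm g ⟨y, (chartEquiv c y (hKc c hy)).symm v⟩ := by
    intro c hc y hy v
    have h1 : C₀ c ≤ C := (hC₁ _ (Finset.mem_image_of_mem _ hc)).trans (le_max_left _ _)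
    exact ⟨(hC₀ c y hy v).1.trans (mul_le_mul_of_nonneg_right h1 (by positivity)),
      (hC₀ c y hy v).2.trans (mul_le_mul_of_nonneg_right h1 (metricForm_nonneg g _))⟩
  have hD : ∀ c ∈ t, ∀ y ∈ K c, ‖P c y‖ ≤ D := fun c hc y hy =>
    (hD₀ c y hy).trans ((hD₁ _ (Finset.mem_image_of_mem _ hc)).trans (le_max_left _ _))
  -- There is no circularity: `C` and `D` depend on the metric and the splitting, which all iterates
  -- share.
  obtain ⟨N, hN⟩ : ∃ N : ℕ, θ ^ (N + 1) * (C ^ 2 * (1 + D) ^ 2) < 1 / 64 := by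
    have : Tendsto (fun n : ℕ => θ ^ (n + 1) * (C ^ 2 * (1 + D) ^ 2)) atTop (𝓝 0) := by
      simpa using ((tendsto_pow_atTop_nhds_zero_of_lt_one hθ0.le hθ).comp
        (tendsto_add_atTop_nat 1)).mul_const (C ^ 2 * (1 + D) ^ 2)
    exact (this.eventually_lt_const (by norm_num)).exists
  obtain ⟨k, hk, hh⟩ := hf.exists_iterate hθ0.le N
  set h := k.trans f
  have hhf : f^[N + 1] = h := by
    funext x
    rw [Function.iterate_succ_apply', ← hk]
    rfl
  refine ⟨N, D, fun y => chartAt E (i y), fun y => P (i y) y, ?_⟩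
  rw [hhf]
  refine ⟨hD0, ?_, ?_, ?_⟩
  · intro ρ hρ
    obtain ⟨δ, hδ, H⟩ := exists_pos_forall_mem_finset (α := ℝ≥0∞) ⟨1, one_pos⟩ t
      (p := fun c δ => ∀ y ∈ K c, ∀ z, edist z y < δ → ‖chartAt E c z - chartAt E c y‖ < ρ)
      (fun c δ δ' hle H y hy z hz => H y hy z (hz.trans_le hle)) (fun c _ => by
        obtain ⟨δ, hδ, H⟩ := mem_uniformity_edist.1
          ((hK c).uniformContinuousAt_of_continuousAt (chartAt E c)
            (fun a ha => (chartAt E c).continuousAt (hKc c ha)) (Metric.dist_mem_uniformity hρ))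
        refine ⟨δ, hδ, fun y hy z hz => ?_⟩
        rw [← dist_eq_norm, dist_comm]
        exact H (by rwa [edist_comm]) hy)
    refine ⟨min δ δ₀, lt_min hδ hδ₀, fun y hy z hz => ⟨(hL _).2 (hiL y hy z (hz.trans_le
        (min_le_right _ _))),
      H _ (hit y hy) y (hself' y hy) z (hz.trans_le (min_le_left _ _))⟩⟩
  · intro η hη
    obtain ⟨ρ, hρ, H⟩ := exists_pos_forall_mem_finset (α := ℝ) ⟨1, one_pos⟩ t
      (p := fun c ρ => ∀ y ∈ K c, ∀ v, ‖v‖ ≤ ρ → chartAt E c y + v ∈ (chartAt E c).target ∧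
        edist ((chartAt E c).symm (chartAt E c y + v)) y < η)
      (fun c δ δ' hle H y hy v hv => H y hy v (hv.trans hle)) (fun c _ => by
        have hQ : IsCompact (chartAt E c '' K c) :=
          (hK c).image_of_continuousOn ((chartAt E c).continuousOn.mono (hKc c))
        have hQt : chartAt E c '' K c ⊆ (chartAt E c).target := by
          rintro _ ⟨y, hy, rfl⟩
          exact (chartAt E c).map_source (hKc c hy)
        obtain ⟨ρ₁, hρ₁, H₁⟩ := hQ.exists_cthickening_subset_open (chartAt E c).open_target hQt
        obtain ⟨ρ₂, hρ₂, H₂⟩ := Metric.mem_uniformity_dist.1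
          (hQ.uniformContinuousAt_of_continuousAt (chartAt E c).symm
            (fun a ha => (chartAt E c).continuousAt_symm (hQt ha)) (edist_mem_uniformity hη))
        refine ⟨min ρ₁ (ρ₂ / 2), by positivity, fun y hy v hv => ⟨H₁ ?_, ?_⟩⟩
        · refine Metric.closedBall_subset_cthickening (mem_image_of_mem _ hy) _ ?_
          simpa using hv.trans (min_le_left _ _)
        · have h1 : dist (chartAt E c y) (chartAt E c y + v) < ρ₂ := by
            rw [dist_self_add_right]
            exact hv.trans_lt ((min_le_right _ _).trans_lt (by linarith))
          have h2 := H₂ h1 (mem_image_of_mem _ hy)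
          rw [(chartAt E c).left_inv (hKc c hy)] at h2
          rw [edist_comm]
          exact h2)
    exact ⟨ρ, hρ, fun y hy v hv => H _ (hit y hy) y (hself' y hy) v hv⟩
  · intro ε hε
    obtain ⟨δ, hδ, Hδ⟩ := exists_pos_forall_mem_finset (α := ℝ≥0∞) ⟨1, one_pos⟩ t
      (p := fun c δ => ∀ y ∈ K c, ∀ z ∈ K c, edist y z < δ → ‖P c z - P c y‖ < ε)
      (fun c δ δ' hle H y hy z hz hyz => H y hy z hz (hyz.trans_le hle)) (fun c _ => by
        obtain ⟨δ, hδ, H⟩ := EMetric.uniformContinuousOn_iff.1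
          ((hK c).uniformContinuousOn_of_continuous (hPK c)) (ENNReal.ofReal ε)
          (ENNReal.ofReal_pos.2 hε)
        refine ⟨δ, hδ, fun y hy z hz hyz => ?_⟩
        have := H hy hz hyz
        rwa [edist_lt_ofReal, dist_comm, dist_eq_norm] at this)
    obtain ⟨ρ, hρ, Hρ⟩ := exists_pos_forall_mem_finset (α := ℝ) ⟨1, one_pos⟩ (t ×ˢ t)
      (p := fun c ρ => ∀ y ∈ K c.1 ∩ h ⁻¹' K c.2,
        (∀ v, ‖v‖ ≤ ρ → h ((chartAt E c.1).symm (chartAt E c.1 y + v)) ∈ (chartAt E c.2).source) ∧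
        ∀ v w, ‖v‖ ≤ ρ → ‖w‖ ≤ ρ →
          ‖chartAt E c.2 (h ((chartAt E c.1).symm (chartAt E c.1 y + v))) -
            chartAt E c.2 (h ((chartAt E c.1).symm (chartAt E c.1 y + w))) -
            fderiv ℝ (fun v => chartAt E c.2 (h ((chartAt E c.1).symm v))) (chartAt E c.1 y)
                (v - w)‖
              ≤ ε * ‖v - w‖)
      (fun c δ δ' hle H y hy => ⟨fun v hv => (H y hy).1 v (hv.trans hle),
        fun v w hv hw => (H y hy).2 v w (hv.trans hle) (hw.trans hle)⟩) (fun c _ => by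
        obtain ⟨c, c'⟩ := c
        have hS : IsCompact (K c ∩ h ⁻¹' K c') := (hK c).inter_right ((hK c').isClosed.preimage
            h.continuous)
        obtain ⟨ρ, hρ, H⟩ := exists_uniform_strict_fderiv (isOpen_chartAt_comp_domain h c c')
          (contDiffOn_chartAt_comp h c c')
          (hS.image_of_continuousOn ((chartAt E c).continuousOn.mono (inter_subset_left.trans
              (hKc c))))
          (by
            rintro _ ⟨y, ⟨hy, hy'⟩, rfl⟩
            refine ⟨(chartAt E c).map_source (hKc c hy), ?_⟩
            rw [mem_preimage, (chartAt E c).left_inv (hKc c hy)]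
            exact hKc c' hy') hε
        refine ⟨ρ, hρ, fun y hy => ?_⟩
        have H1 := H _ (mem_image_of_mem _ hy)
        have hb : ∀ v, ‖v‖ ≤ ρ → chartAt E c y + v ∈ Metric.closedBall (chartAt E c y) ρ :=
          fun v hv => by simpa using hv
        refine ⟨fun v hv => (H1.1 (hb v hv)).2, fun v w hv hw => ?_⟩
        have H2 := H1.2 _ (hb v hv) _ (hb w hw)
        rwa [add_sub_add_left_eq_sub] at H2)
    refine ⟨min δ δ₀, lt_min hδ hδ₀, ρ, hρ, fun y hy z hz hyz => ?_⟩
    have hyK := hself' y hy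
    have hzK := hself' z hz
    have hhyK : h y ∈ K (i z) := ⟨hh.apply_mem hy, hiL z hz _ (hyz.trans_le (min_le_right _ _))⟩
    obtain ⟨h1, h2⟩ := Hρ (i y, i z) (Finset.mem_product.2 ⟨hit y hy, hit z hz⟩) y ⟨hyK, hhyK⟩
    obtain ⟨A, hA, hPP, hAP, hs, hu⟩ := hh.chart_estimates (by positivity) hy (hKc _ hyK)
        (hKc _ hhyK)
      hC0 (D := D) (by rw [mul_assoc]; exact hN.le) (hC _ (hit y hy) y hyK) (hC _ (hit z hz) _ hhyK)
      (fun v => hP _ y hy _ v) (fun v => hP _ _ (hh.apply_mem hy) _ v)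
      (hD _ (hit y hy) y hyK) (hD _ (hit z hz) _ hhyK)
    -- The exact image projection is the one at `h y`. It is read in the chart of `z`, so uniform
    -- continuity within that chart compares it with the projection at `z`.
    refine ⟨h1, A, P (i z) (h y), hPP, hAP, hs, hu,
      fun v => (P (i z) (h y)).le_of_opNorm_le (hD _ (hit z hz) _ hhyK) v, fun v => ?_, ?_⟩
    · rw [← sub_apply]
      exact ContinuousLinearMap.le_of_opNorm_le _
        (Hδ _ (hit z hz) _ hhyK z hzK (hyz.trans_le (min_le_left _ _))).le v
    · intro v w hv hw
      have h3 := h2 v w hv hw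
      rw [(hasFDerivAt_chartAt_comp h (hKc _ hyK) (hKc _ hhyK)).fderiv, ← hA] at h3
      rwa [sub_sub_sub_cancel_right]

end Coordinates

/-! ### Comparing Bowen entropies of two sets -/

section EntropyComparison

variable {X : Type*}

/-- A finite lower bound on the escape time is a finite list of subordination conditions, which
passes to thickened sets. -/
theorem natCast_le_escapeTime_iff {T : X → X} {𝒜 : Set (Set X)} {U : Set X} {n : ℕ} :
    (n : ℕ∞) ≤ escapeTime T 𝒜 U ↔ ∀ ℓ < n, Subordinate (T^[ℓ] '' U) 𝒜 := by
  classical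
  unfold escapeTime
  split_ifs with h
  · rw [Nat.cast_le, Nat.le_find_iff]
    simp
  · push Not at h
    simp [h]

theorem expNeg_anti {d : ℝ} (hd : 0 ≤ d) {m n : ℕ∞} (h : m ≤ n) : expNeg d n ≤ expNeg d m := by
  unfold expNeg
  split_ifs with hn hm hm
  · exact le_rfl
  · exact zero_le
  · exact absurd (top_le_iff.1 (hm ▸ h)) hn
  · refine ENNReal.ofReal_le_ofReal (Real.exp_le_exp.2 (neg_le_neg ?_))
    exact mul_le_mul_of_nonneg_left (Nat.cast_le.2 (ENat.toNat_le_toNat h hn)) hd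

theorem tendsto_expNeg {d : ℝ} (hd : 0 < d) :
    Tendsto (fun n : ℕ => expNeg d (n : ℕ∞)) atTop (𝓝 0) := by
  have h : Tendsto (fun n : ℕ => Real.exp (-(d * (n : ℝ)))) atTop (𝓝 0) :=
    Real.tendsto_exp_neg_atTop_nhds_zero.comp
      (tendsto_natCast_atTop_atTop.const_mul_atTop hd)
  have h2 := ENNReal.tendsto_ofReal h
  rw [ENNReal.ofReal_zero] at h2
  refine h2.congr fun n => ?_
  rw [expNeg, if_neg (ENat.natCast_ne_top n), ENat.toNat_natCast]

theorem bowenMeasure_eq_zero_iff [TopologicalSpace X] {T : X → X} {𝒜 : Set (Set X)} {d : ℝ}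
    {Y : Set X} : bowenMeasure T 𝒜 d Y = 0 ↔ ∀ ρ > 0, ∀ ε > 0, ∃ 𝒰 ∈ AdmissibleCovers T 𝒜 Y ρ,
      ∑' U : 𝒰, expNeg d (escapeTime T 𝒜 (U : Set X)) < ε := by
  simp only [bowenMeasure, ENNReal.iSup_eq_zero]
  refine forall₂_congr fun ρ _ => ⟨fun h ε hε => ?_, fun h => ?_⟩
  · rw [← h] at hε
    simpa only [gt_iff_lt, iInf_lt_iff, exists_prop] using hε
  · by_contra hne
    obtain ⟨𝒰, h𝒰, hlt⟩ := h _ (pos_iff_ne_zero.2 hne)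
    exact absurd (iInf₂_le 𝒰 h𝒰) (not_le.2 hlt)

theorem bowenEntropy_mono [TopologicalSpace X] (T : X → X) {Y Z : Set X} (h : Y ⊆ Z) :
    bowenEntropy T Y ≤ bowenEntropy T Z := by
  refine iSup₂_mono fun 𝒜 _ => iInf₂_mono fun d _ => ?_
  refine le_iInf fun hd => iInf_le _ ?_
  rw [bowenMeasure_eq_zero_iff] at hd ⊢
  intro ρ hρ ε hε
  obtain ⟨𝒰, ⟨h1, h2, h3, h4⟩, h5⟩ := hd ρ hρ ε hε
  exact ⟨𝒰, ⟨h1, h2, h.trans h3, h4⟩, h5⟩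

variable [PseudoEMetricSpace X]

/-- Every finite open cover is refined, with room to spare, by another one. -/
theorem IsFiniteOpenCover.exists_refinement [CompactSpace X] {𝒜 : Set (Set X)}
    (h𝒜 : IsFiniteOpenCover 𝒜) : ∃ 𝒞 : Set (Set X), IsFiniteOpenCover 𝒞 ∧ ∃ δ > 0,
      ∀ S : Set X, Subordinate S 𝒞 → Subordinate {p | ∃ q ∈ S, edist p q < δ} 𝒜 := by
  obtain ⟨δ₀, hδ₀, h⟩ := lebesgue_number_lemma_of_emetric (s := univ) (c :=
      fun A : 𝒜 => (A : Set X))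
    isCompact_univ (fun A => h𝒜.2.1 A A.2) (by rw [← sUnion_eq_iUnion, h𝒜.2.2])
  obtain ⟨δ, hδ, hδδ⟩ : ∃ δ : ℝ≥0∞, 0 < δ ∧ δ + δ ≤ δ₀ :=
    ⟨δ₀ / 2, ENNReal.half_pos hδ₀.ne', (ENNReal.add_halves _).le⟩
  obtain ⟨t, -, ht⟩ := (isCompact_univ (X := X)).elim_nhds_subcover (fun x => Metric.eball x δ)
    fun x _ => Metric.eball_mem_nhds x hδ
  refine ⟨(fun x => Metric.eball x δ) '' t, ⟨t.finite_toSet.image _, ?_, ?_⟩, δ, hδ, ?_⟩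
  · rintro _ ⟨x, -, rfl⟩
    exact Metric.isOpen_eball
  · rw [sUnion_image]
    exact univ_subset_iff.1 ht
  · rintro S ⟨_, ⟨x, -, rfl⟩, hS⟩
    obtain ⟨A, hA⟩ := h x (mem_univ x)
    refine ⟨A, A.2, fun p hp => hA ?_⟩
    obtain ⟨q, hq, hpq⟩ := hp
    exact (edist_triangle p q x).trans_lt ((ENNReal.add_lt_add hpq (hS hq)).trans_le hδδ)

/-- If the forward orbit of every point of `Z` is followed, arbitrarily closely and for all times,
by that of a point of `Y`, then the entropy on `Z` is at most that on `Y`. -/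
theorem bowenEntropy_le_of_forall_exists_edist_lt [CompactSpace X] {T : X → X} (hT : Continuous T)
    {Y Z : Set X}
    (h : ∀ δ > 0, ∀ p ∈ Z, ∃ q ∈ Y, ∀ k, edist (T^[k] p) (T^[k] q) < δ) :
    bowenEntropy T Z ≤ bowenEntropy T Y := by
  refine iSup₂_le fun 𝒜 h𝒜 => ?_
  obtain ⟨𝒞, h𝒞, δ, hδ, hsub⟩ := h𝒜.exists_refinement
  refine le_trans ?_ (le_iSup₂ 𝒞 h𝒞)
  refine iInf₂_mono fun d hd => le_iInf fun hm => iInf_le _ ?_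
  rw [bowenMeasure_eq_zero_iff] at hm ⊢
  intro ρ hρ ε hε
  have hε2 : 0 < ε / 2 := ENNReal.half_pos hε.ne'
  obtain ⟨𝒰, ⟨h𝒰c, h𝒰o, h𝒰Y, h𝒰ρ⟩, hsum⟩ := hm ρ hρ (ε / 2) hε2
  have : Countable 𝒰 := h𝒰c
  obtain ⟨e, he, hesum⟩ := ENNReal.exists_pos_sum_of_countable' hε2.ne' 𝒰
  -- An infinite escape time is truncated at a large finite `n`, at a cost below the summable error
  -- `e V`. Finiteness makes the thickenings `W V` open.
  have hn : ∀ V : 𝒰, ∃ n : ℕ, (n : ℕ∞) ≤ escapeTime T 𝒞 V ∧ expNeg 1 n < ENNReal.ofReal ρ ∧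
      expNeg d n ≤ expNeg d (escapeTime T 𝒞 V) + e V := by
    intro V
    by_cases hV : escapeTime T 𝒞 V = ⊤
    · obtain ⟨n, h1, h2⟩ := (((tendsto_expNeg one_pos).eventually_lt_const
        (ENNReal.ofReal_pos.2 hρ)).and ((tendsto_expNeg hd).eventually_lt_const (he V))).exists
      exact ⟨n, hV ▸ le_top, h1, h2.le.trans le_add_self⟩
    · obtain ⟨n, hn⟩ := ENat.ne_top_iff_exists.1 hV
      exact ⟨n, hn.le, hn ▸ h𝒰ρ V V.2, hn ▸ le_self_add⟩
  choose n hn1 hn2 hn3 using hn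
  let W : 𝒰 → Set X := fun V => {p | ∃ q ∈ (V : Set X), ∀ k < n V, edist (T^[k] p) (T^[k] q) < δ}
  have hWo : ∀ V, IsOpen (W V) := by
    intro V
    have : W V = ⋃ q ∈ (V : Set X), ⋂ k ∈ Finset.range (n V),
        {p | edist (T^[k] p) (T^[k] q) < δ} := by
      ext p
      simp [W]
    rw [this]
    refine isOpen_biUnion fun q _ => isOpen_biInter_finset fun k _ => ?_
    exact isOpen_lt ((hT.iterate k).edist continuous_const) continuous_const
  have hWn : ∀ V, (n V : ℕ∞) ≤ escapeTime T 𝒜 (W V) := by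
    intro V
    rw [natCast_le_escapeTime_iff]
    intro ℓ hℓ
    obtain ⟨A, hA, hA2⟩ := hsub _ (natCast_le_escapeTime_iff.1 (hn1 V) ℓ hℓ)
    refine ⟨A, hA, Subset.trans ?_ hA2⟩
    rintro _ ⟨p, ⟨q, hq, hpq⟩, rfl⟩
    exact ⟨_, mem_image_of_mem _ hq, hpq ℓ hℓ⟩
  refine ⟨range W, ⟨countable_range W, ?_, ?_, ?_⟩, ?_⟩
  · rintro _ ⟨V, rfl⟩
    exact hWo V
  · intro p hp
    obtain ⟨q, hq, hpq⟩ := h δ hδ p hp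
    obtain ⟨V, hV, hqV⟩ := h𝒰Y hq
    exact ⟨_, ⟨⟨V, hV⟩, rfl⟩, q, hqV, fun k _ => hpq k⟩
  · rintro _ ⟨V, rfl⟩
    exact (expNeg_anti zero_le_one (hWn V)).trans_lt (hn2 V)
  · calc ∑' S : range W, expNeg d (escapeTime T 𝒜 (S : Set X))
        ≤ ∑' V : 𝒰, expNeg d (escapeTime T 𝒜 (W V)) :=
          ENNReal.tsum_le_tsum_comp_of_surjective (f := rangeFactorization W)
            rangeFactorization_surjective (fun S : range W => expNeg d (escapeTime T 𝒜 (S : Set X)))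
      _ ≤ ∑' V : 𝒰, (expNeg d (escapeTime T 𝒞 V) + e V) :=
          ENNReal.tsum_le_tsum fun V => (expNeg_anti (le_of_lt hd) (hWn V)).trans (hn3 V)
      _ = ∑' V : 𝒰, expNeg d (escapeTime T 𝒞 V) + ∑' V : 𝒰, e V := ENNReal.tsum_add
      _ < ε / 2 + ε / 2 := ENNReal.add_lt_add hsum hesum
      _ = ε := ENNReal.add_halves ε

end EntropyComparison

/-! ### Heteroclinic points from expansivity, product structure and mixing -/

section LocalProductStructure

variable {X : Type*} [PseudoEMetricSpace X]

/-- Distinct points are separated, at some time, by more than `η`. -/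
def IsExpansive (T : Equiv.Perm X) (η : ℝ≥0∞) : Prop :=
  ∀ a b : X, (∀ n : ℤ, edist ((T ^ n) a) ((T ^ n) b) < η) → a = b

/-- For nearby points `p` and `z`, there is a point whose forward orbit follows that of `p` and
whose backward orbit follows that of `z`. -/
def HasLocalProductStructure (T : Equiv.Perm X) : Prop :=
  ∀ η > 0, ∃ δ > 0, ∀ p z : X, edist p z < δ → ∃ q : X,
    (∀ k : ℕ, edist ((T ^ k) q) ((T ^ k) p) < η) ∧
    ∀ k : ℕ, edist ((T⁻¹ ^ k) q) ((T⁻¹ ^ k) z) < η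

theorem IsExpansive.inv {T : Equiv.Perm X} {η : ℝ≥0∞} (h : IsExpansive T η) :
    IsExpansive T⁻¹ η := fun a b hab => h a b fun n => by
  simpa using hab (-n)

theorem continuous_zpow {T : Equiv.Perm X} (hT : Continuous T) (hT' : Continuous ⇑T⁻¹) (n : ℤ) :
    Continuous ⇑(T ^ n) := by
  cases n with
  | ofNat n =>
    rw [Int.ofNat_eq_natCast, zpow_natCast, Equiv.Perm.coe_pow]
    exact hT.iterate n
  | negSucc n =>
    rw [zpow_negSucc, ← inv_pow, Equiv.Perm.coe_pow]
    exact hT'.iterate _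

variable [CompactSpace X]

/-- A limit pair of the two orbits along times tending to infinity stays `η'`-close over its whole
two-sided orbit, since every integer shift is eventually a nonnegative time. Expansivity then makes
the two limits equal. -/
theorem IsExpansive.tendsto_edist {T : Equiv.Perm X} (hT : Continuous T) (hT' : Continuous ⇑T⁻¹)
    {η η' : ℝ≥0∞} (h : IsExpansive T η) (hη : η' < η) {p q : X}
    (hpq : ∀ k : ℕ, edist ((T ^ k) q) ((T ^ k) p) ≤ η') :
    Tendsto (fun k : ℕ => edist ((T ^ k) q) ((T ^ k) p)) atTop (𝓝 0) := by
  refine tendsto_of_subseq_tendsto fun ns hns => ?_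
  obtain ⟨⟨a, b⟩, ms, hms', hlim⟩ :=
    CompactSpace.tendsto_subseq fun k => ((T ^ ns k) q, (T ^ ns k) p)
  have hms := hms'.tendsto_atTop
  have ha : Tendsto (fun k => (T ^ ns (ms k)) q) atTop (𝓝 a) := (continuous_fst.tendsto _).comp hlim
  have hb : Tendsto (fun k => (T ^ ns (ms k)) p) atTop (𝓝 b) := (continuous_snd.tendsto _).comp hlim
  have hnm : Tendsto (fun k => ns (ms k)) atTop atTop := hns.comp hms
  have hab : a = b := by
    refine h a b fun n => lt_of_le_of_lt ?_ hη
    have hc := continuous_zpow hT hT' n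
    refine le_of_tendsto (((hc.tendsto a).comp ha).edist ((hc.tendsto b).comp hb)) ?_
    filter_upwards [hnm.eventually_ge_atTop n.natAbs] with k hk
    obtain ⟨m, hm⟩ : ∃ m : ℕ, n + (ns (ms k) : ℤ) = m := Int.eq_ofNat_of_zero_le (by omega)
    have := hpq m
    rwa [← zpow_natCast, ← hm, zpow_add, zpow_natCast] at this
  refine ⟨ms, ?_⟩
  have := ha.edist hb
  rwa [hab, edist_self] at this

/-- Mixing and one use of the product structure yield a point `z` near `p` that is backward
asymptotic to `x`. A second use, for `p` and `z`, yields `q`; expansivity turns closeness into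
convergence. -/
theorem HasLocalProductStructure.exists_heteroclinic {T : Equiv.Perm X} (hT : Continuous T)
    (hT' : Continuous ⇑T⁻¹) {η₀ : ℝ≥0∞} (hη₀ : 0 < η₀) (hexp : IsExpansive T η₀)
    (hlps : HasLocalProductStructure T) (hmix : IsTopologicallyMixing T) {η : ℝ≥0∞} (hη : 0 < η)
    (x p : X) : ∃ q : X, (∀ k : ℕ, edist ((T ^ k) q) ((T ^ k) p) < η) ∧
      Tendsto (fun k : ℕ => edist ((T ^ k) q) ((T ^ k) p)) atTop (𝓝 0) ∧
      Tendsto (fun k : ℕ => edist ((T⁻¹ ^ k) q) ((T⁻¹ ^ k) x)) atTop (𝓝 0) := by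
  obtain ⟨η', hη', hlt⟩ := exists_between (lt_min hη hη₀)
  have hback : ∀ {a b : X}, (∀ k : ℕ, edist ((T⁻¹ ^ k) a) ((T⁻¹ ^ k) b) < η') →
      Tendsto (fun k : ℕ => edist ((T⁻¹ ^ k) a) ((T⁻¹ ^ k) b)) atTop (𝓝 0) := fun hab =>
    hexp.inv.tendsto_edist hT' (by rwa [inv_inv]) (hlt.trans_le (min_le_right _ _))
      fun k => (hab k).le
  obtain ⟨δ, hδ, h₁⟩ := hlps η' hη'
  obtain ⟨δ₂, hδ₂, hδδ⟩ : ∃ δ₂ : ℝ≥0∞, 0 < δ₂ ∧ δ₂ + δ₂ ≤ δ :=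
    ⟨δ / 2, ENNReal.half_pos hδ.ne', (ENNReal.add_halves _).le⟩
  obtain ⟨δ', hδ', h₂⟩ := hlps (min δ₂ η') (lt_min hδ₂ hη')
  obtain ⟨δ₃, hδ₃, hδδ'⟩ : ∃ δ₃ : ℝ≥0∞, 0 < δ₃ ∧ δ₃ + δ₃ ≤ δ' :=
    ⟨δ' / 2, ENNReal.half_pos hδ'.ne', (ENNReal.add_halves _).le⟩
  obtain ⟨z, hzp, hzx⟩ : ∃ z, edist p z < δ ∧
      Tendsto (fun k : ℕ => edist ((T⁻¹ ^ k) z) ((T⁻¹ ^ k) x)) atTop (𝓝 0) := by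
    -- The mixing time depends on the open sets. Using a fixed ball around an accumulation point of
    -- the backward orbit of `x` makes it independent of how far back one goes.
    obtain ⟨a, ms, hms, hlim⟩ := CompactSpace.tendsto_subseq fun k : ℕ => (T⁻¹ ^ k) x
    obtain ⟨N, hN⟩ := hmix (Metric.eball a δ₃) (Metric.eball p δ₂) Metric.isOpen_eball
      Metric.isOpen_eball ⟨a, Metric.mem_eball_self hδ₃⟩ ⟨p, Metric.mem_eball_self hδ₂⟩
    obtain ⟨k, hk1, hk2⟩ := ((hms.tendsto_atTop.eventually_ge_atTop N).and
      (hlim.eventually (Metric.eball_mem_nhds a hδ₃))).exists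
    obtain ⟨_, ⟨p', hp', rfl⟩, hp'p⟩ := hN (ms k) hk1
    set n := ms k
    rw [← Equiv.Perm.coe_pow] at hp'p
    have hk2' : edist ((T⁻¹ ^ n) x) a < δ₃ := hk2
    obtain ⟨q, hq1, hq2⟩ := h₂ p' ((T⁻¹ ^ n) x) (by
      refine (edist_triangle_right p' _ a).trans_lt ?_
      exact (ENNReal.add_lt_add hp' hk2').trans_le hδδ')
    -- `q` follows `p'` forward, so after `n` steps it is near `p`; it follows `(T⁻¹ ^ n) x`
    -- backward, so its image is backward asymptotic to `x`.
    refine ⟨(T ^ n) q, ?_, ?_⟩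
    · rw [edist_comm]
      refine (edist_triangle _ ((T ^ n) p') _).trans_lt ?_
      exact (ENNReal.add_lt_add ((hq1 n).trans_le (min_le_left _ _)) hp'p).trans_le hδδ
    · rw [← tendsto_add_atTop_iff_nat n]
      refine (hback fun k => (hq2 k).trans_le (min_le_right _ _)).congr fun j => ?_
      have : (T⁻¹ ^ n) ((T ^ n) q) = q := by
        rw [← Equiv.Perm.mul_apply, inv_pow, inv_mul_cancel, Equiv.Perm.one_apply]
      rw [pow_add, Equiv.Perm.mul_apply, Equiv.Perm.mul_apply, this]
  obtain ⟨q, hq1, hq2⟩ := h₁ p z hzp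
  refine ⟨q, fun k => (hq1 k).trans (hlt.trans_le (min_le_left _ _)),
    hexp.tendsto_edist hT hT' (hlt.trans_le (min_le_right _ _)) fun k => (hq1 k).le, ?_⟩
  have hsum := (hback hq2).add hzx
  rw [add_zero] at hsum
  exact tendsto_of_tendsto_of_tendsto_of_le_of_le tendsto_const_nhds hsum (fun _ => zero_le)
    fun k => edist_triangle _ _ _

end LocalProductStructure

/-! ### Basic sets and the entropy formula -/

section BasicSets

theorem coe_subtypePerm_zpow {M : Type*} {Γ : Set M} {T : Equiv.Perm M} (hΓ : ∀ x, T x ∈ Γ ↔ x ∈ Γ)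
    (n : ℤ) (a : Γ) : (((T.subtypePerm hΓ ^ n : Equiv.Perm Γ) a : Γ) : M) = (T ^ n) a := by
  rw [Equiv.Perm.subtypePerm_zpow]
  rfl

namespace HyperbolicCoordinates

variable {E : Type*} [NormedAddCommGroup E] [NormedSpace ℝ E] {M : Type*} [EMetricSpace M]
  {Γ : Set M} {T : Equiv.Perm M} {C : ℝ} {N : ℕ} {ψ : M → OpenPartialHomeomorph M E}
  {P : M → E →L[ℝ] E}

/-- Orbits of `T` sampled at multiples of `N + 1` are orbits of the iterate, so its expansivity
constant serves for `T`. -/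
theorem isExpansive_subtypePerm (H : HyperbolicCoordinates Γ T^[N + 1] C ψ P)
    (hΓ : ∀ x, T x ∈ Γ ↔ x ∈ Γ) : ∃ η > 0, IsExpansive (T.subtypePerm hΓ) η := by
  obtain ⟨η, hη, h⟩ := H.exists_expansivity
  refine ⟨η, hη, fun a b hab => Subtype.ext ?_⟩
  simp only [Equiv.Perm.subtypePerm_zpow] at hab
  have hstep : ∀ (x : M) (n : ℤ), (T ^ (((N + 1 : ℕ) : ℤ) * (n + 1))) x =
      T^[N + 1] ((T ^ (((N + 1 : ℕ) : ℤ) * n)) x) := by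
    intro x n
    rw [← Equiv.Perm.coe_pow, ← Equiv.Perm.mul_apply, ← zpow_natCast, ← zpow_add, mul_add, mul_one,
      add_comm (((N + 1 : ℕ) : ℤ) * n)]
  have := h (fun n => (T ^ (((N + 1 : ℕ) : ℤ) * n)) (b : M)) (fun n => (T ^ (((N + 1 : ℕ) : ℤ) *
      n)) (a : M))
    (fun n => coe_subtypePerm_zpow hΓ _ b ▸ Subtype.coe_prop _)
    (hstep _) (hstep _) (fun n => hab _)
  simpa using congrFun this 0

/-- The past of `z` glued to the future of `p` is a pseudo-orbit of the iterate with a single jump,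
from time -1 to time 0. Its shadowing orbit stays near `Γ` at intermediate times too, so local
maximality puts it in `Γ`. -/
theorem hasLocalProductStructure_subtypePerm [CompleteSpace E]
    (H : HyperbolicCoordinates Γ T^[N + 1] C ψ P) (hΓ : ∀ x, T x ∈ Γ ↔ x ∈ Γ) (hc : IsCompact Γ)
    (hT : Continuous T) (hmax : IsLocallyMaximal T Γ) :
    HasLocalProductStructure (T.subtypePerm hΓ) := by
  intro η hη
  obtain ⟨V, hV, hΓV⟩ := hmax
  obtain ⟨O, hO, hΓO, hOV⟩ := mem_nhdsSet_iff_exists.1 hV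
  obtain ⟨r, hr, hrO⟩ := hc.exists_thickening_subset_open hO hΓO
  set η₁ := min η (ENNReal.ofReal r)
  have hη₁ : 0 < η₁ := lt_min hη (ENNReal.ofReal_pos.2 hr)
  have hnear : ∀ y ∈ Γ, ∀ z, edist z y < η₁ → z ∈ V := fun y hy z hz =>
    hOV (hrO ((Metric.mem_thickening_iff_exists_edist_lt _ _).2 ⟨y, hy,
        hz.trans_le (min_le_right _ _)⟩))
  -- The exponents run up to `N + 1`, one more than the remainders modulo `N + 1`, because of the
  -- shift used for backward times below.
  obtain ⟨η₂, hη₂, huc⟩ := exists_pos_forall_mem_finset (α := ℝ≥0∞) ⟨1,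
      one_pos⟩ (Finset.range (N + 2))
    (p := fun j δ => ∀ y ∈ Γ, ∀ z, edist z y < δ → edist (T^[j] z) (T^[j] y) < η₁)
    (fun j δ δ' hle H y hy z hz => H y hy z (hz.trans_le hle)) (fun j _ => by
      obtain ⟨δ, hδ, h⟩ := mem_uniformity_edist.1 (hc.uniformContinuousAt_of_continuousAt (T^[j])
        (fun a _ => (hT.iterate j).continuousAt) (edist_mem_uniformity hη₁))
      refine ⟨δ, hδ, fun y hy z hz => ?_⟩
      rw [edist_comm] at hz ⊢
      exact h hz hy)
  obtain ⟨δ, hδ, hsh⟩ := H.exists_shadowing hη₂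
  refine ⟨δ, hδ, fun p z hpz => ?_⟩
  set L : ℤ := ((N + 1 : ℕ) : ℤ)
  have hL : 0 < L := by positivity
  have hpow : ∀ (x : M) (n : ℤ) (j : ℕ), T^[j] ((T ^ n) x) = (T ^ (n + j)) x := by
    intro x n j
    rw [← Equiv.Perm.coe_pow, ← Equiv.Perm.mul_apply, add_comm, zpow_add, zpow_natCast]
  have hmem : ∀ (n : ℤ) (x : Γ), (T ^ n) (x : M) ∈ Γ := fun n x =>
    coe_subtypePerm_zpow hΓ n x ▸ Subtype.coe_prop _
  let y : ℤ → M := fun n => if 0 ≤ n then (T ^ (L * n)) (p : M) else (T ^ (L * n)) (z : M)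
  have hy : ∀ n, y n ∈ Γ := by
    intro n
    dsimp only [y]
    split_ifs
    · exact hmem _ p
    · exact hmem _ z
  obtain ⟨q, hq, hqy⟩ := hsh y hy (by
    intro n
    rcases lt_trichotomy n (-1) with h | rfl | h
    · have h1 : ¬ 0 ≤ n := by omega
      have h2 : ¬ 0 ≤ n + 1 := by omega
      simp only [y, if_neg h1, if_neg h2, hpow, mul_add, mul_one, L, edist_self]
      exact hδ
    · have h1 : ¬ (0 : ℤ) ≤ -1 := by omega
      simp only [y, if_neg h1, hpow]
      rw [edist_comm]
      simpa [L] using! hpz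
    · have h1 : 0 ≤ n := by omega
      have h2 : 0 ≤ n + 1 := by omega
      simp only [y, if_pos h1, if_pos h2, hpow, mul_add, mul_one, L, edist_self]
      exact hδ)
  have hq0 : ∀ n, q n = (T ^ (L * n)) (q 0) := by
    have h1 : ∀ n, q (n + 1) = (T ^ L) (q n) := fun n => by
      rw [hq n, ← Equiv.Perm.coe_pow, zpow_natCast]
    intro n
    induction n using Int.induction_on with
    | zero => simp
    | succ k ih => rw [h1, ih, ← Equiv.Perm.mul_apply, ← zpow_add]; ring_nf
    | pred k ih =>
      have h2 := h1 (-(k : ℤ) - 1)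
      rw [sub_add_cancel, ih] at h2
      have h3 : q (-(k : ℤ) - 1) = (T ^ (-L)) ((T ^ (L * -(k : ℤ))) (q 0)) := by
        rw [h2, ← Equiv.Perm.mul_apply, ← zpow_add]
        simp
      rw [h3, ← Equiv.Perm.mul_apply, ← zpow_add]
      ring_nf
  have hclose : ∀ (m : ℤ) (j : ℕ), j < N + 2 →
      edist ((T ^ (L * m + j)) (q 0)) (T^[j] (y m)) < η₁ := by
    intro m j hj
    have := huc j (Finset.mem_range.2 hj) (y m) (hy m) (q m) (hqy m)
    rwa [hq0 m, hpow] at this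
  have hqV : ∀ n : ℤ, (T ^ n) (q 0) ∈ V := by
    intro n
    obtain ⟨j, hj⟩ := Int.eq_ofNat_of_zero_le (Int.emod_nonneg n hL.ne')
    have h1 := Int.mul_ediv_add_emod n L
    have h2 := Int.emod_lt_of_pos n hL
    rw [hj] at h1 h2
    have h3 := hclose (n / L) j (by omega)
    rw [h1] at h3
    refine hnear _ ?_ _ h3
    have := hmem j ⟨_, hy (n / L)⟩
    rwa [zpow_natCast, Equiv.Perm.coe_pow] at this
  have hqΓ : q 0 ∈ Γ := by
    rw [hΓV]
    refine mem_iInter.2 fun n => ⟨(T ^ (-n)) (q 0), hqV _, ?_⟩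
    rw [← Equiv.Perm.mul_apply, ← zpow_add]
    simp
  refine ⟨⟨q 0, hqΓ⟩, fun k => ?_, fun k => ?_⟩
  · obtain ⟨j, hj⟩ := Int.eq_ofNat_of_zero_le (Int.emod_nonneg (k : ℤ) hL.ne')
    have h1 := Int.mul_ediv_add_emod (k : ℤ) L
    have h2 := Int.emod_lt_of_pos (k : ℤ) hL
    have h0 : 0 ≤ (k : ℤ) / L := Int.ediv_nonneg (by omega) hL.le
    rw [hj] at h1 h2
    have h3 := hclose (k / L) j (by omega)
    simp only [y, if_pos h0, hpow, h1] at h3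
    rw [Equiv.Perm.subtypePerm_pow]
    exact h3.trans_le (min_le_left _ _)
  -- Dividing `-k - 1` instead of `-k` makes the quotient negative even for `k = 0`, so the
  -- comparison is always with the orbit of `z`; the lost step is restored by the exponent `j + 1`.
  · obtain ⟨j, hj⟩ := Int.eq_ofNat_of_zero_le (Int.emod_nonneg (-(k : ℤ) - 1) hL.ne')
    have h1 := Int.mul_ediv_add_emod (-(k : ℤ) - 1) L
    have h2 := Int.emod_lt_of_pos (-(k : ℤ) - 1) hL
    have h0 : ¬ 0 ≤ (-(k : ℤ) - 1) / L := by
      rw [not_le]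
      exact Int.ediv_neg_of_neg_of_pos (by omega) hL
    rw [hj] at h1 h2
    have h4 : L * ((-(k : ℤ) - 1) / L) + ((j + 1 : ℕ) : ℤ) = -(k : ℤ) := by push_cast; omega
    have h3 := hclose ((-(k : ℤ) - 1) / L) (j + 1) (by omega)
    simp only [y, if_neg h0, hpow, h4] at h3
    rw [inv_pow, ← zpow_natCast, ← zpow_neg, Equiv.Perm.subtypePerm_zpow]
    exact h3.trans_le (min_le_left _ _)

end HyperbolicCoordinates

variable {E : Type*} [NormedAddCommGroup E] [NormedSpace ℝ E] [FiniteDimensional ℝ E]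
  {M : Type*} [EMetricSpace M] [ChartedSpace E M] [IsManifold 𝓘(ℝ, E) 1 M]

/-- Every forward orbit in a basic set is followed closely, and eventually asymptotically, by the
orbit of a point of any prescribed unstable manifold. -/
theorem IsBasicSet.exists_heteroclinic {f : M ≃ₘ^1⟮𝓘(ℝ, E), 𝓘(ℝ, E)⟯ M} {Γ : Set M}
    (hΓ : IsBasicSet 𝓘(ℝ, E) f Γ) {η : ℝ≥0∞} (hη : 0 < η) {x p : M} (hx : x ∈ Γ) (hp : p ∈ Γ) :
    ∃ q ∈ Γ, (∀ k : ℕ, edist (f^[k] q) (f^[k] p) < η) ∧ q ∈ stableManifold f p ∧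
      q ∈ stableManifold f.symm x := by
  obtain ⟨g, Es, Eu, θ, hθ0, hθ, hf⟩ := hΓ.hyperbolic.exists_isSplitHyperbolic hΓ.image_eq
  obtain ⟨N, C, ψ, P, H⟩ := hf.exists_hyperbolicCoordinates hθ0 hθ hΓ.isCompact
  have hinv : ∀ x, f.toEquiv x ∈ Γ ↔ x ∈ Γ := fun x => by
    conv_lhs => rw [← hΓ.image_eq]
    exact f.injective.mem_set_image
  have : CompactSpace Γ := isCompact_iff_compactSpace.1 hΓ.isCompact
  set T : Equiv.Perm Γ := Equiv.Perm.subtypePerm f.toEquiv hinv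
  have hTf : ∀ (k : ℕ) (a : Γ), ((T ^ k) a : M) = f^[k] a := by
    intro k a
    rw [← zpow_natCast, coe_subtypePerm_zpow, zpow_natCast, Equiv.Perm.coe_pow]
    rfl
  have hTf' : ∀ (k : ℕ) (a : Γ), ((T⁻¹ ^ k) a : M) = f.symm^[k] a := by
    intro k a
    rw [inv_pow, ← zpow_natCast, ← zpow_neg, coe_subtypePerm_zpow, zpow_neg, zpow_natCast,
        ← inv_pow,
      Equiv.Perm.coe_pow]
    rfl
  have hT : Continuous T := (f.continuous.comp continuous_subtype_val).subtype_mk _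
  have hT' : Continuous ⇑T⁻¹ := (f.symm.continuous.comp continuous_subtype_val).subtype_mk _
  obtain ⟨η₀, hη₀, hexp⟩ := H.isExpansive_subtypePerm (T := f.toEquiv) hinv
  have hlps := H.hasLocalProductStructure_subtypePerm (T := f.toEquiv) hinv hΓ.isCompact
      f.continuous
    hΓ.locallyMaximal
  obtain ⟨q, h1, h2, h3⟩ := hlps.exists_heteroclinic hT hT' hη₀ hexp hΓ.mixing hη ⟨x, hx⟩ ⟨p, hp⟩
  refine ⟨q, q.2, fun k => ?_, ?_, ?_⟩
  · have := h1 k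
    rwa [Subtype.edist_eq, hTf, hTf] at this
  · refine h2.congr fun k => ?_
    rw [Subtype.edist_eq, hTf, hTf]
  · refine h3.congr fun k => ?_
    rw [Subtype.edist_eq, hTf', hTf']

theorem IsBasicSet.bowenEntropy_inter_localUnstableManifold {f : M ≃ₘ^1⟮𝓘(ℝ, E), 𝓘(ℝ, E)⟯ M}
    {Γ : Set M} (hΓ : IsBasicSet 𝓘(ℝ, E) f Γ) {U : Set M} (hU : U ∈ 𝓝ˢ Γ) {B : Set M}
    (hB : IsSSaturated f U Γ B) {x : M} (hx : x ∈ Γ) :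
    bowenEntropy (hΓ.mapsTo.restrict f Γ Γ)
        (Subtype.val ⁻¹' (B ∩ localUnstableManifold f.toEquiv U x) : Set Γ) =
      bowenEntropy (hΓ.mapsTo.restrict f Γ Γ) (Subtype.val ⁻¹' B : Set Γ) := by
  have : CompactSpace Γ := isCompact_iff_compactSpace.1 hΓ.isCompact
  have hΓU : Γ ⊆ U := subset_of_mem_nhdsSet hU
  have hsymm : MapsTo f.symm Γ Γ := by
    intro y hy
    rw [← hΓ.image_eq] at hy
    obtain ⟨z, hz, rfl⟩ := hy
    rwa [f.symm_apply_apply]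
  refine le_antisymm (bowenEntropy_mono _ (preimage_mono inter_subset_left)) ?_
  refine bowenEntropy_le_of_forall_exists_edist_lt (f.continuous.restrict hΓ.mapsTo)
    fun η hη p hp => ?_
  obtain ⟨q, hq, h1, h2, h3⟩ := hΓ.exists_heteroclinic hη hx p.2
  -- Both orbit conditions in `U` hold because the full orbit of `q` stays in `Γ`; saturation then
  -- gives `q ∈ B`.
  refine ⟨⟨q, hq⟩, ⟨hB.2 p hp ⟨hq, h2, fun k => hΓU (hΓ.mapsTo.iterate k hq)⟩, h3,
    fun k => hΓU (hsymm.iterate k hq)⟩, fun k => ?_⟩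
  rw [Subtype.edist_eq, edist_comm, MapsTo.iterate_restrict]
  exact h1 k

end BasicSets

end SurfaceDynamics

end

theorem mainTheorem8
    {M : Type*} [EMetricSpace M] [ChartedSpace (EuclideanSpace ℝ (Fin 2)) M]
    [IsManifold (𝓡 2) ∞ M]
    [RiemannianBundle (fun x : M => TangentSpace (𝓡 2) x)]
    [IsContMDiffRiemannianBundle (𝓡 2) ∞ (EuclideanSpace ℝ (Fin 2))
      (fun x : M => TangentSpace (𝓡 2) x)]
    [IsRiemannianManifold (𝓡 2) M]
    (f : M ≃ₘ^1⟮𝓡 2, 𝓡 2⟯ M)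
    (Γ : Set M) (hΓ : SurfaceDynamics.IsBasicSet (𝓡 2) f Γ)
    (U : Set M) (hU : U ∈ 𝓝ˢ Γ)
    (B : Set M) (hBsat : SurfaceDynamics.IsSSaturated f U Γ B) (hBinv : f '' B = B)
    (x : M) (hx : x ∈ Γ) :
    SurfaceDynamics.bowenEntropy (hΓ.mapsTo.restrict f Γ Γ)
        (Subtype.val ⁻¹' (B ∩ SurfaceDynamics.localUnstableManifold f.toEquiv U x) : Set Γ) =
      SurfaceDynamics.bowenEntropy (hΓ.mapsTo.restrict f Γ Γ)
        (Subtype.val ⁻¹' B : Set Γ) := by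
  exact hΓ.bowenEntropy_inter_localUnstableManifold hU hBsat hx
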